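/- Let $n\ge 6$, let $G$ be a simple graph on $n$ vertices with a proper 2-colouring, with colour classes $S_1,S_2$ (possibly empty), and let $|G\rangle=\prod_{(i,j)\in E}CZ_{ij}\,|+\rangle^{\otimes n}$ be its graph state. Put $K=\lceil n^2\log n\rceil$ (natural logarithm). A possibly dishonest server Bob sends to Charlie $5K$ registers of $n$ qubits each, in an arbitrary joint (possibly entangled) state $\sigma$. Charlie keeps a uniformly random set of $2K$ registers and sends the remaining $3K$ registers to client Alice$_1$. Verification of $2K$ registers means the following. A uniformly random set of $K$ of them forms group 1 and the other $K$ form group 2. In each register of group $j$ the qubits of $S_j$ are measured in the $X$ basis (results $x_i=\pm1$) and all the others in the $Z$ basis (results $z_k=\pm1$), and $M_j=\prod_{i\in S_j}\frac12\bigl(1+x_i\prod_{k\in N(i)}z_k\bigr)\in\{0,1\}$ is computed. $K_j$ is the number of registers of group $j$ with $M_j=0$. All probabilities are over the random selections and the measurement results. (1) Alice$_1$ verifies a uniformly random set of $2K$ of her $3K$ registers. Let $F=\langle G|\varrho|G\rangle$, where $\varrho$ is the state, given her selections and measurement results, of a uniformly random one of her remaining $K$ registers (that is, the average of their $K$ reduced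 states). Then for every real $\lambda_1$ with $\log_n 16\le\lambda_1\le (n-1)^2/16$, with probability at least $1-4n^{-\lambda_1/2}$ the following implication holds: if $K_1+K_2\le \frac{K}{2n}$, then $F\ge 1-\frac{4\sqrt{\lambda_1}+1}{n}$. (2) A third-party verifier Alice$_t$ verifies the $2K$ registers held by Charlie. Let $F=\langle G|\varrho|G\rangle$, where $\varrho$ is the state, given the selections and Alice$_t$'s measurement results, of a uniformly random one of the $3K$ registers that were sent to Alice$_1$, regarded as not measured by her. Then for every real $\lambda_2$ with $\log_n 4\le\lambda_2\le (n-1)^2/9$, with probability at least $1-4n^{-\lambda_2}$ the following implication holds: if $K_1+K_2\le \frac{3K}{4n}$, then $F\ge 1-\frac{3\sqrt{\lambda_2}+1}{n}$. In particular, if $\sigma=\varrho_0^{\otimes 5K}$, then $F=\langle G|\varrho_0|G\rangle$ in both parts. -/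

import Mathlib

namespace PVBQC

noncomputable section

/-- Computational basis labels of one `n`-qubit register (`false` is `|0⟩`, `true` is `|1⟩`). -/
abbrev Qubits (n : ℕ) := Fin n → Bool

/-- Computational basis labels of `N` registers of `n` qubits each. -/
abbrev Registers (N n : ℕ) := Fin N → Qubits n

open scoped ComplexOrder in
/-- Density matrices. -/
def IsDensity {ι : Type*} [Fintype ι] (ρ : Matrix ι ι ℂ) : Prop :=
  ρ.PosSemidef ∧ ρ.trace = 1

/-- The number `1 / √2`, as a complex number. -/
def invSqrtTwo : ℂ := ((1 / Real.sqrt 2 : ℝ) : ℂ)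

/-! ### Graph states -/

/-- `|+⟩^{⊗ n}`. -/
def plusState (n : ℕ) : Qubits n → ℂ := fun _ => ∏ _i : Fin n, invSqrtTwo

/-- The controlled-`Z` gate on qubits `i`, `j` of a register, `|0⟩⟨0| ⊗ I + |1⟩⟨1| ⊗ Z`. -/
def czGate {n : ℕ} (i j : Fin n) : Matrix (Qubits n) (Qubits n) ℂ :=
  Matrix.diagonal fun x => if x i = true ∧ x j = true then -1 else 1

theorem czGate_commute {n : ℕ} (i j k l : Fin n) : Commute (czGate i j) (czGate k l) := by
  unfold Commute SemiconjBy czGate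
  rw [Matrix.diagonal_mul_diagonal, Matrix.diagonal_mul_diagonal]
  congr 1
  funext x
  exact mul_comm _ _

open scoped Classical in
/-- The edges of `G`, each listed once, as a pair `(i, j)` with `i < j`. -/
def edgePairs {n : ℕ} (G : SimpleGraph (Fin n)) : Finset (Fin n × Fin n) :=
  Finset.univ.filter fun e => e.1 < e.2 ∧ G.Adj e.1 e.2

/-- The graph state `|G⟩ = (∏_{(i,j) ∈ E} CZ_{ij}) |+⟩^{⊗ n}`. -/
def graphState {n : ℕ} (G : SimpleGraph (Fin n)) : Qubits n → ℂ :=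
  Matrix.mulVec
    ((edgePairs G).noncommProd (fun e => czGate e.1 e.2)
      (fun e _ f _ _ => czGate_commute e.1 e.2 f.1 f.2))
    (plusState n)

/-- The fidelity `⟨ψ| ρ |ψ⟩` of a state with a pure state. -/
def fidelity {ι : Type*} [Fintype ι] (ψ : ι → ℂ) (ρ : Matrix ι ι ℂ) : ℝ :=
  (dotProduct (star ψ) (Matrix.mulVec ρ ψ)).re

/-! ### Local measurement of one register -/

/-- Eigenvector of `Z` for the result `+1` (`b = false`) or `-1` (`b = true`). -/
def zVec (b : Bool) : Bool → ℂ := fun x => if x = b then 1 else 0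

/-- Eigenvector of `X` for the result `+1` (`b = false`) or `-1` (`b = true`). -/
def xVec (b : Bool) : Bool → ℂ :=
  fun x => if x = true ∧ b = true then -invSqrtTwo else invSqrtTwo

/-- The number `±1` that an outcome bit stands for. -/
def outcomeSign (b : Bool) : ℝ := if b = true then -1 else 1

/-- The set `S_j` of vertices of colour `j`. -/
def colorSet {n : ℕ} {G : SimpleGraph (Fin n)} (c : G.Coloring (Fin 2)) (j : Fin 2) :
    Finset (Fin n) :=
  Finset.univ.filter fun i => c i = j

/-- In the setting with set `S`, the qubits in `S` are measured in the `X` basis and all other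
qubits in the `Z` basis. This is the product vector that belongs to the results `o`. -/
def outcomeVec {n : ℕ} (S : Finset (Fin n)) (o : Qubits n) : Qubits n → ℂ :=
  fun x => ∏ i, if i ∈ S then xVec (o i) (x i) else zVec (o i) (x i)

/-- The projector onto `outcomeVec S o`. -/
def outcomeProj {n : ℕ} (S : Finset (Fin n)) (o : Qubits n) : Matrix (Qubits n) (Qubits n) ℂ :=
  Matrix.vecMulVec (outcomeVec S o) (star (outcomeVec S o))

open scoped Classical in
/-- The value `M_j = ∏_{i ∈ S_j} (x_i ∏_{k ∈ N(i)} z_k + 1) / 2` computed from the results `o`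
of the `j`-th setting. -/
def passValue {n : ℕ} {G : SimpleGraph (Fin n)} (c : G.Coloring (Fin 2)) (j : Fin 2)
    (o : Qubits n) : ℝ :=
  ∏ i ∈ colorSet c j,
    (outcomeSign (o i) * (∏ k ∈ Finset.univ.filter (fun k => G.Adj i k), outcomeSign (o k)) + 1) / 2

/-! ### Measuring two groups of registers of a joint state -/

/-- The operator `⊗_k A_k` on the joint space of `N` registers. -/
def tensorOp {N n : ℕ} (A : Fin N → Matrix (Qubits n) (Qubits n) ℂ) :
    Matrix (Registers N n) (Registers N n) ℂ :=
  fun x y => ∏ k, A k (x k) (y k)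

/-- The reduced state of register `r` (partial trace over all other registers). -/
def reducedState {N n : ℕ} (σ : Matrix (Registers N n) (Registers N n) ℂ) (r : Fin N) :
    Matrix (Qubits n) (Qubits n) ℂ :=
  fun x y => ∑ z : Registers N n, if z r = x then σ z (Function.update z r y) else 0

/-- The results of all local measurements on the registers in the groups `A` and `B`. -/
abbrev MeasRecord {N : ℕ} (n : ℕ) (A B : Finset (Fin N)) := {k : Fin N // k ∈ A ∪ B} → Qubits n

/-- The projector of the results `o`, when the registers of the first group `A` are measured in the
setting of `S_1` (colour `0`), those of the second group `B` in the setting of `S_2` (colour `1`),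
and the other registers are left alone. -/
def recordProj {N n : ℕ} {G : SimpleGraph (Fin n)} (c : G.Coloring (Fin 2)) (A B : Finset (Fin N))
    (o : MeasRecord n A B) : Matrix (Registers N n) (Registers N n) ℂ :=
  tensorOp fun k =>
    if h : k ∈ A ∪ B then outcomeProj (colorSet c (if k ∈ A then 0 else 1)) (o ⟨k, h⟩) else 1

/-- Unnormalised joint state after the results `o`. -/
def collapsed {N n : ℕ} {G : SimpleGraph (Fin n)} (c : G.Coloring (Fin 2))
    (σ : Matrix (Registers N n) (Registers N n) ℂ) (A B : Finset (Fin N))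
    (o : MeasRecord n A B) : Matrix (Registers N n) (Registers N n) ℂ :=
  recordProj c A B o * σ * recordProj c A B o

/-- Born probability of the results `o`. -/
def bornProb {N n : ℕ} {G : SimpleGraph (Fin n)} (c : G.Coloring (Fin 2))
    (σ : Matrix (Registers N n) (Registers N n) ℂ) (A B : Finset (Fin N))
    (o : MeasRecord n A B) : ℝ :=
  (collapsed c σ A B o).trace.re

/-- Joint state after the results `o` (of positive probability). -/
def postState {N n : ℕ} {G : SimpleGraph (Fin n)} (c : G.Coloring (Fin 2))
    (σ : Matrix (Registers N n) (Registers N n) ℂ) (A B : Finset (Fin N))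
    (o : MeasRecord n A B) : Matrix (Registers N n) (Registers N n) ℂ :=
  ((bornProb c σ A B o : ℂ))⁻¹ • collapsed c σ A B o

/-- The fidelity with `|G⟩`, after the results `o`, of the state of a uniformly random register
in `R`. -/
def restFidelity {N n : ℕ} {G : SimpleGraph (Fin n)} (c : G.Coloring (Fin 2))
    (σ : Matrix (Registers N n) (Registers N n) ℂ) (A B R : Finset (Fin N))
    (o : MeasRecord n A B) : ℝ :=
  fidelity (graphState G)
    ((R.card : ℂ)⁻¹ • ∑ r ∈ R, reducedState (postState c σ A B o) r)

open scoped Classical in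
/-- The number of registers in a group `T`, measured in the setting of `S_j`, for which
`M_j = 0`. -/
def failCount {N n : ℕ} {G : SimpleGraph (Fin n)} (c : G.Coloring (Fin 2)) (A B : Finset (Fin N))
    (o : MeasRecord n A B) (j : Fin 2) (T : Finset (Fin N)) : ℕ :=
  (Finset.univ.filter fun k : {k : Fin N // k ∈ A ∪ B} =>
    k.1 ∈ T ∧ passValue c j (o k) = 0).card

open scoped Classical in
/-- One run of the verification algorithm on the held registers `H`: a uniformly random set `A` of
`K` of them is the first group, and `H \ A` is the second group. The value is the probability
(over the choice of `A` and the measurement results) of the event `E K₁ K₂ F`, where `F` is the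
fidelity of a uniformly random register in `R` after the measurement. -/
def verificationProb {N n : ℕ} {G : SimpleGraph (Fin n)} (c : G.Coloring (Fin 2))
    (σ : Matrix (Registers N n) (Registers N n) ℂ) (K : ℕ) (H R : Finset (Fin N))
    (E : ℕ → ℕ → ℝ → Prop) : ℝ :=
  Finset.expect (Finset.powersetCard K H) fun A =>
    ∑ o : MeasRecord n A (H \ A),
      if E (failCount c A (H \ A) o 0 A) (failCount c A (H \ A) o 1 (H \ A))
          (restFidelity c σ A (H \ A) R o)
      then bornProb c σ A (H \ A) o else 0

/-! ### The protocol -/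

/-- `K = ⌈n² log n⌉`. -/
def copies (n : ℕ) : ℕ := ⌈(n : ℝ) ^ 2 * Real.log n⌉₊

/-- Charlie keeps a uniformly random set `C` of `2K` of the `5K` registers and sends the other `3K`
to the first client, who runs the verification on a uniformly random set `D` of `2K` of these;
the `K` registers that she has not measured remain. -/
def firstClientProb {n : ℕ} {G : SimpleGraph (Fin n)} (c : G.Coloring (Fin 2))
    (σ : Matrix (Registers (5 * copies n) n) (Registers (5 * copies n) n) ℂ)
    (E : ℕ → ℕ → ℝ → Prop) : ℝ :=
  Finset.expect (Finset.powersetCard (2 * copies n) Finset.univ) fun C =>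
    Finset.expect (Finset.powersetCard (2 * copies n) Cᶜ) fun D =>
      verificationProb c σ (copies n) D (Cᶜ \ D) E

/-- Charlie keeps a uniformly random set `C` of `2K` of the `5K` registers, on which the third-party
verifier runs the verification; the other `3K` registers are those that were sent to the first
client. -/
def thirdPartyProb {n : ℕ} {G : SimpleGraph (Fin n)} (c : G.Coloring (Fin 2))
    (σ : Matrix (Registers (5 * copies n) n) (Registers (5 * copies n) n) ℂ)
    (E : ℕ → ℕ → ℝ → Prop) : ℝ :=
  Finset.expect (Finset.powersetCard (2 * copies n) Finset.univ) fun C =>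
    verificationProb c σ (copies n) C Cᶜ E

end

end PVBQC

namespace PVBQC

/-! ### Sampling without replacement -/

/-! On one register the two pass projectors multiply, in either order, to |G⟩⟨G|. Hence they
commute, and the infidelity operator 1 - |G⟩⟨G| is at most the sum of the two fail projectors
(`posSemidef_union_bound`). The infidelity of the unmeasured registers is therefore at most the sum
of their mean probabilities to fail either test, given the results (`one_sub_restFidelity_le`).

Each of these must be compared with the failure rate of the group that took the same test, although
the registers may be entangled. Exponential moments reduce this to a classical question. By
convexity, the conditional mean on the rest may be replaced by the actual failure fraction in a
hypothetical test of those registers. The uncounted registers contribute complete measurements,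
which sum to the identity, so all registers may be imagined to take test `j`
(`sum_bornProb_mul_exp_le`). The fail bits then form one random string whose law does not depend on
the selections.

For a fixed string only sampling without replacement is left, and `sum_perm_exp_sub_avg_le` bounds
its moment by exp(t² / 2K). Arithmetic-geometric mean joins the two tests, Markov's inequality gives
the tail (`one_sub_le_sum_bornProb`), and `chernoff_exponent_le` turns K ≥ n² log n into a power of
n. -/

theorem sum_perm_exp_le {α ι : Type*} [Fintype α] [DecidableEq α] (x : α → ℝ)
    (hx : ∀ i j, |x i - x j| ≤ 1) (t : ℝ) (a r : ι → α) (S : Finset ι)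
    (ha : Set.InjOn a S) (hr : Set.InjOn r S) (har : ∀ i ∈ S, ∀ j ∈ S, a i ≠ r j) :
    ∑ π : Equiv.Perm α, Real.exp (t * ∑ i ∈ S, (x (π (r i)) - x (π (a i))))
      ≤ Real.exp (t ^ 2 / 2) ^ S.card * Fintype.card (Equiv.Perm α) := by
  classical
  induction S using Finset.induction_on with
  | empty => simp
  | insert j S hj ih =>
    have ih' := ih (ha.mono (by simp)) (hr.mono (by simp))
      (fun i hi k hk => har i (Finset.mem_insert_of_mem hi) k (Finset.mem_insert_of_mem hk))
    set Y : Equiv.Perm α → ℝ := fun π => Real.exp (t * ∑ i ∈ S, (x (π (r i)) - x (π (a i))))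
      with hY
    -- Symmetrisation: composing with the swap of `a j` and `r j` permutes the summation range,
    -- leaves the other pairs alone, and reverses the sign of the new difference. Averaging the two
    -- versions turns exp into cosh.
    have hinv : ∀ π, Y (π * Equiv.swap (a j) (r j)) = Y π := by
      intro π
      simp only [hY, Equiv.Perm.mul_apply]
      congr 2
      refine Finset.sum_congr rfl fun i hi => ?_
      have hij : i ≠ j := fun h => hj (h ▸ hi)
      have hi' := Finset.mem_insert_of_mem (a := i) (b := j) hi
      have hj' := Finset.mem_insert_self j S
      rw [Equiv.swap_apply_of_ne_of_ne (fun h => har _ hj' _ hi' h.symm)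
          (fun h => hij (hr hi' hj' h)),
        Equiv.swap_apply_of_ne_of_ne (fun h => hij (ha hi' hj' h)) (har _ hi' _ hj')]
    set d : Equiv.Perm α → ℝ := fun π => x (π (r j)) - x (π (a j)) with hd
    have hdsw : ∀ π, d (π * Equiv.swap (a j) (r j)) = -d π := by
      intro π; simp [hd]
    have h1 : ∑ π, Real.exp (t * d π) * Y π = ∑ π, Real.exp (-(t * d π)) * Y π := by
      rw [← Equiv.sum_comp (Equiv.mulRight (Equiv.swap (a j) (r j)))]
      refine Finset.sum_congr rfl fun π _ => ?_
      simp only [Equiv.coe_mulRight, hinv, hdsw, mul_neg]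
    have h2 : ∑ π, Real.exp (t * d π) * Y π = ∑ π, Real.cosh (t * d π) * Y π := by
      have : ∑ π, Real.cosh (t * d π) * Y π
          = (∑ π, Real.exp (t * d π) * Y π + ∑ π, Real.exp (-(t * d π)) * Y π) / 2 := by
        rw [← Finset.sum_add_distrib, Finset.sum_div]
        refine Finset.sum_congr rfl fun π _ => ?_
        rw [Real.cosh_eq]; ring
      rw [this, ← h1]; ring
    calc ∑ π : Equiv.Perm α, Real.exp (t * ∑ i ∈ insert j S, (x (π (r i)) - x (π (a i))))
        = ∑ π, Real.exp (t * d π) * Y π := by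
          refine Finset.sum_congr rfl fun π _ => ?_
          rw [Finset.sum_insert hj, mul_add, Real.exp_add]
      _ = ∑ π, Real.cosh (t * d π) * Y π := h2
      _ ≤ ∑ π, Real.exp (t ^ 2 / 2) * Y π := by
          refine Finset.sum_le_sum fun π _ => mul_le_mul_of_nonneg_right ?_ (Real.exp_pos _).le
          refine (Real.cosh_le_exp_half_sq _).trans (Real.exp_le_exp.2 ?_)
          have h := hx (π (r j)) (π (a j))
          have hd1 : d π ^ 2 ≤ 1 := by rw [← sq_abs]; exact pow_le_one₀ (abs_nonneg _) h
          rw [mul_pow]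
          nlinarith [sq_nonneg t]
      _ = Real.exp (t ^ 2 / 2) * ∑ π, Y π := by rw [Finset.mul_sum]
      _ ≤ _ := by
          rw [Finset.card_insert_of_notMem hj, pow_succ' (Real.exp _), mul_assoc]
          exact mul_le_mul_of_nonneg_left ih' (Real.exp_pos _).le

/-- Since `R` is `m` times as large as `A`, it splits into `m` blocks each matched with `A`. The
difference of means is the average of the block differences, and Jensen reduces the claim to the
paired bound for one block. -/
theorem sum_perm_exp_sub_avg_le {α : Type*} [Fintype α] [DecidableEq α] (x : α → ℝ)
    (hx : ∀ i j, |x i - x j| ≤ 1) (t : ℝ) (A R : Finset α) (hAR : Disjoint A R) {m : ℕ}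
    (hm : 0 < m) (hA : 0 < A.card) (hR : R.card = m * A.card) :
    ∑ π : Equiv.Perm α, Real.exp (t * ((∑ r ∈ R, x (π r)) / R.card - (∑ a ∈ A, x (π a)) / A.card))
      ≤ Real.exp (t ^ 2 / (2 * A.card)) * Fintype.card (Equiv.Perm α) := by
  classical
  have hcard : Fintype.card (Fin m × A) = Fintype.card R := by simp [hR]
  let e : Fin m × A ≃ R := Fintype.equivOfCardEq hcard
  have hm' : (0 : ℝ) < m := by exact_mod_cast hm
  have hA' : (0 : ℝ) < A.card := by exact_mod_cast hA
  have hsum : ∀ π : Equiv.Perm α,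
      t * ((∑ r ∈ R, x (π r)) / R.card - (∑ a ∈ A, x (π a)) / A.card)
        = ∑ l : Fin m, (m : ℝ)⁻¹ • ((t / A.card) *
            ∑ i ∈ (Finset.univ : Finset A), (x (π (e (l, i))) - x (π i))) := by
    intro π
    have h1 : ∑ r ∈ R, x (π r) = ∑ l : Fin m, ∑ i : A, x (π (e (l, i))) := by
      rw [← Finset.sum_coe_sort R (fun r => x (π r)), ← Equiv.sum_comp e, Fintype.sum_prod_type]
    rw [h1, ← Finset.sum_coe_sort A (fun r => x (π r)), ← Finset.smul_sum, ← Finset.mul_sum]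
    simp only [Finset.sum_sub_distrib, Finset.sum_const, Finset.card_univ, Fintype.card_fin, hR,
      smul_eq_mul, nsmul_eq_mul]
    push_cast
    field_simp
  have hj : ∀ π : Equiv.Perm α,
      Real.exp (t * ((∑ r ∈ R, x (π r)) / R.card - (∑ a ∈ A, x (π a)) / A.card))
        ≤ ∑ l : Fin m, (m : ℝ)⁻¹ • Real.exp ((t / A.card) *
            ∑ i ∈ (Finset.univ : Finset A), (x (π (e (l, i))) - x (π i))) := by
    intro π
    rw [hsum]
    refine convexOn_exp.map_sum_le (fun _ _ => by positivity) ?_ (fun _ _ => Set.mem_univ _)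
    simp [hm'.ne']
  calc _ ≤ ∑ π : Equiv.Perm α, ∑ l : Fin m, (m : ℝ)⁻¹ • Real.exp ((t / A.card) *
            ∑ i ∈ (Finset.univ : Finset A), (x (π (e (l, i))) - x (π i))) :=
        Finset.sum_le_sum fun π _ => hj π
    _ = ∑ l : Fin m, (m : ℝ)⁻¹ * ∑ π : Equiv.Perm α, Real.exp ((t / A.card) *
            ∑ i ∈ (Finset.univ : Finset A), (x (π (e (l, i))) - x (π i))) := by
        rw [Finset.sum_comm]
        simp only [smul_eq_mul, Finset.mul_sum]
    _ ≤ ∑ l : Fin m, (m : ℝ)⁻¹ * (Real.exp ((t / A.card) ^ 2 / 2) ^ (Finset.univ : Finset A).card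
          * Fintype.card (Equiv.Perm α)) := by
        refine Finset.sum_le_sum fun l _ => mul_le_mul_of_nonneg_left ?_ (by positivity)
        refine sum_perm_exp_le x hx _ (fun i : A => (i : α)) (fun i => (e (l, i) : α)) _
          Subtype.val_injective.injOn ?_ ?_
        · intro i _ k _ h
          have := e.injective (Subtype.ext h)
          exact (Prod.ext_iff.1 this).2
        · intro i _ k _ h
          exact Finset.disjoint_left.1 hAR i.2 (h ▸ (e (l, k)).2)
    _ = _ := by
        simp only [Finset.sum_const, Finset.card_univ, Fintype.card_fin, nsmul_eq_mul,
          Fintype.card_coe]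
        rw [← mul_assoc, mul_inv_cancel₀ hm'.ne', one_mul, ← Real.exp_nat_mul]
        congr 2
        field_simp

theorem expect_powersetCard_map {α : Type*} (e : α ↪ α) (k : ℕ) (H : Finset α)
    (f : Finset α → ℝ) :
    Finset.expect (Finset.powersetCard k (H.map e)) f
      = Finset.expect (Finset.powersetCard k H) fun A => f (A.map e) := by
  rw [Finset.powersetCard_map]
  simp only [Finset.expect, Finset.sum_map, Finset.card_map]
  rfl

/-- A uniform selection is invariant under relabelling, so its average may also be averaged over all
permutations. It then suffices to bound the permutation average at each fixed selection `y`. -/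
theorem expect_le_of_perm {α : Type*} [Fintype α] [DecidableEq α] {β : Type*} (s : Finset β)
    (hs : s.Nonempty) (f : Equiv.Perm α → β → ℝ) (v b : ℝ)
    (hv : ∀ π, v = Finset.expect s (f π))
    (hb : ∀ y ∈ s, ∑ π, f π y ≤ b * Fintype.card (Equiv.Perm α)) : v ≤ b := by
  have hc : (0 : ℝ) < Fintype.card (Equiv.Perm α) := by exact_mod_cast Fintype.card_pos
  have h1 : v * Fintype.card (Equiv.Perm α) = Finset.expect s fun y => ∑ π, f π y := by
    rw [Finset.expect_sum_comm, ← Finset.sum_congr rfl fun π _ => hv π]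
    simp [mul_comm]
  have h2 : v * Fintype.card (Equiv.Perm α) ≤ b * Fintype.card (Equiv.Perm α) := by
    rw [h1]
    exact Finset.expect_le hs hb
  exact le_of_mul_le_mul_right h2 hc

end PVBQC
namespace PVBQC

/-! ### One register -/

theorem invSqrtTwo_mul_self : invSqrtTwo * invSqrtTwo = 1 / 2 := by
  unfold invSqrtTwo
  rw [← Complex.ofReal_mul, div_mul_div_comm, Real.mul_self_sqrt (by norm_num)]
  norm_num

theorem star_invSqrtTwo : star invSqrtTwo = invSqrtTwo := Complex.conj_ofReal _

theorem star_outcomeVec {n : ℕ} (S : Finset (Fin n)) (o : Qubits n) :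
    star (outcomeVec S o) = outcomeVec S o := by
  funext x
  simp only [Pi.star_apply, outcomeVec, star_prod]
  refine Finset.prod_congr rfl fun i _ => ?_
  unfold xVec zVec
  split_ifs <;> simp [star_invSqrtTwo]

/-- The one-qubit eigenvector matrices (Hadamard or identity) are symmetric. This makes
orthonormality double as completeness in `sum_outcomeProj`. -/
theorem outcomeVec_comm {n : ℕ} (S : Finset (Fin n)) (o x : Qubits n) :
    outcomeVec S o x = outcomeVec S x o := by
  unfold outcomeVec
  refine Finset.prod_congr rfl fun i _ => ?_
  unfold xVec zVec
  simp only [and_comm, eq_comm]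

theorem outcomeVec_dotProduct {n : ℕ} (S : Finset (Fin n)) (o o' : Qubits n) :
    outcomeVec S o ⬝ᵥ outcomeVec S o' = if o = o' then 1 else 0 := by
  unfold dotProduct outcomeVec
  simp only [← Finset.prod_mul_distrib]
  rw [← Fintype.piFinset_univ, ← Finset.prod_univ_sum (fun _ => Finset.univ)
    (fun i (b : Bool) => (if i ∈ S then xVec (o i) b else zVec (o i) b) *
      (if i ∈ S then xVec (o' i) b else zVec (o' i) b))]
  have h : ∀ i, ∑ b : Bool, (if i ∈ S then xVec (o i) b else zVec (o i) b) *
      (if i ∈ S then xVec (o' i) b else zVec (o' i) b) = if o i = o' i then 1 else 0 := by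
    intro i
    have h2 := invSqrtTwo_mul_self
    by_cases hi : i ∈ S <;> simp only [hi, if_true, if_false, Fintype.sum_bool] <;>
      cases o i <;> cases o' i <;> simp [xVec, zVec, h2] <;> norm_num
  simp only [h]
  by_cases hoo : o = o'
  · simp [hoo]
  · rw [if_neg hoo]
    obtain ⟨i, hi⟩ := Function.ne_iff.1 hoo
    exact Finset.prod_eq_zero (Finset.mem_univ i) (if_neg hi)

theorem outcomeProj_apply {n : ℕ} (S : Finset (Fin n)) (o x y : Qubits n) :
    outcomeProj S o x y = outcomeVec S o x * outcomeVec S o y := by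
  rw [outcomeProj, star_outcomeVec, Matrix.vecMulVec_apply]

theorem outcomeProj_mul {n : ℕ} (S : Finset (Fin n)) (o o' : Qubits n) :
    outcomeProj S o * outcomeProj S o' = if o = o' then outcomeProj S o else 0 := by
  unfold outcomeProj
  rw [Matrix.vecMulVec_mul_vecMulVec, star_outcomeVec, outcomeVec_dotProduct]
  split_ifs with h
  · simp [h, star_outcomeVec]
  · simp

theorem sum_outcomeProj {n : ℕ} (S : Finset (Fin n)) : ∑ o, outcomeProj S o = 1 := by
  ext x y
  have h := outcomeVec_dotProduct S x y
  rw [Matrix.sum_apply, Matrix.one_apply, ← h]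
  refine Finset.sum_congr rfl fun o _ => ?_
  rw [outcomeProj_apply, outcomeVec_comm S o x, outcomeVec_comm S o y]

open scoped ComplexOrder in
theorem posSemidef_outcomeProj {n : ℕ} (S : Finset (Fin n)) (o : Qubits n) :
    (outcomeProj S o).PosSemidef :=
  Matrix.posSemidef_vecMulVec_self_star _

noncomputable section

variable {n : ℕ} {G : SimpleGraph (Fin n)}

open scoped Classical in
/-- Whether the results `o` of the `j`-th setting fail the test. -/
def failBit (c : G.Coloring (Fin 2)) (j : Fin 2) (o : Qubits n) : Bool :=
  decide (passValue c j o = 0)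

/-- The projector onto the outcomes of the `j`-th setting with fail bit `b`. -/
def bitOp (c : G.Coloring (Fin 2)) (j : Fin 2) (b : Bool) : Matrix (Qubits n) (Qubits n) ℂ :=
  ∑ o, if failBit c j o = b then outcomeProj (colorSet c j) o else 0

theorem sum_bitOp (c : G.Coloring (Fin 2)) (j : Fin 2) : ∑ b, bitOp c j b = 1 := by
  unfold bitOp
  rw [Finset.sum_comm, ← sum_outcomeProj (colorSet c j)]
  simp

theorem sum_smul_outcomeProj (c : G.Coloring (Fin 2)) (j : Fin 2) (u : Bool → ℂ) :
    ∑ o, u (failBit c j o) • outcomeProj (colorSet c j) o = ∑ b, u b • bitOp c j b := by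
  unfold bitOp
  simp only [Finset.smul_sum]
  rw [Finset.sum_comm]
  simp

open scoped ComplexOrder in
theorem posSemidef_bitOp (c : G.Coloring (Fin 2)) (j : Fin 2) (b : Bool) :
    (bitOp c j b).PosSemidef := by
  refine Matrix.posSemidef_sum _ fun o _ => ?_
  split_ifs
  · exact posSemidef_outcomeProj _ _
  · exact Matrix.PosSemidef.zero

theorem bitOp_mul_self (c : G.Coloring (Fin 2)) (j : Fin 2) (b : Bool) :
    bitOp c j b * bitOp c j b = bitOp c j b := by
  unfold bitOp
  rw [Finset.sum_mul_sum]
  refine Finset.sum_congr rfl fun o _ => ?_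
  by_cases h : failBit c j o = b
  · simp [h, outcomeProj_mul]
    rw [Finset.sum_eq_single o] <;> simp +contextual [h, eq_comm]
  · simp [h]

/-! ### Amplitudes of the graph state and the pass projectors -/

/-- The sign of the graph state at a basis label. -/
def graphSign (G : SimpleGraph (Fin n)) (x : Qubits n) : ℂ :=
  ∏ e ∈ edgePairs G, if x e.1 = true ∧ x e.2 = true then -1 else 1

theorem graphSign_mul_self (x : Qubits n) : graphSign G x * graphSign G x = 1 := by
  unfold graphSign
  rw [← Finset.prod_mul_distrib]
  refine Finset.prod_eq_one fun e _ => ?_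
  split_ifs <;> simp

theorem star_graphSign (x : Qubits n) : star (graphSign G x) = graphSign G x := by
  unfold graphSign
  rw [star_prod]
  refine Finset.prod_congr rfl fun e _ => ?_
  split_ifs <;> simp

theorem graphState_apply (G : SimpleGraph (Fin n)) (x : Qubits n) :
    graphState G x = graphSign G x * invSqrtTwo ^ n := by
  have h : ∀ (s : Finset (Fin n × Fin n))
      (hs : (s : Set (Fin n × Fin n)).Pairwise (Function.onFun Commute fun e => czGate e.1 e.2)),
      s.noncommProd (fun e => czGate e.1 e.2) hs
      = Matrix.diagonal fun x => ∏ e ∈ s, if x e.1 = true ∧ x e.2 = true then (-1 : ℂ) else 1 := by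
    classical
    intro s
    induction s using Finset.induction_on with
    | empty => intro hs; simp
    | insert a s ha ih =>
      intro hs
      rw [Finset.noncommProd_insert_of_notMem _ _ _ _ ha, ih, czGate, Matrix.diagonal_mul_diagonal]
      simp only [Finset.prod_insert ha]
  refine (congrFun (congrArg (fun M => Matrix.mulVec M (plusState n))
    (h (edgePairs G) _)) x).trans ?_
  simp [graphSign, plusState, Matrix.mulVec_diagonal]

-- Every edge has exactly one endpoint of colour `j`. The bijection orients an edge by colour in one
-- direction and by the order on `Fin n` in the other.
open scoped Classical in
theorem graphSign_eq_prod_colorSet (c : G.Coloring (Fin 2)) (j : Fin 2) (x : Qubits n) :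
    graphSign G x = ∏ i ∈ colorSet c j, ∏ k ∈ Finset.univ.filter (fun k => G.Adj i k),
      if x i = true ∧ x k = true then -1 else 1 := by
  rw [graphSign, Finset.prod_sigma']
  refine Finset.prod_bij'
    (fun e _ => if c e.1 = j then ⟨e.1, e.2⟩ else ⟨e.2, e.1⟩)
    (fun p _ => if p.1 < p.2 then (p.1, p.2) else (p.2, p.1)) ?_ ?_ ?_ ?_ ?_
  · rintro ⟨a, b⟩ h
    simp only [edgePairs, Finset.mem_filter, Finset.mem_univ, true_and] at h
    have hne := c.valid h.2
    by_cases ha : c a = j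
    · simp [ha, colorSet, h.2]
    · have : c b = j := by omega
      simp [ha, colorSet, h.2.symm, this]
  · rintro ⟨a, b⟩ h
    simp only [colorSet, Finset.mem_sigma, Finset.mem_filter, Finset.mem_univ, true_and] at h
    have hne := h.2.ne
    by_cases hab : a < b
    · simp [hab, edgePairs, h.2]
    · have : b < a := by omega
      simp [hab, edgePairs, h.2.symm, this]
  · rintro ⟨a, b⟩ h
    simp only [edgePairs, Finset.mem_filter, Finset.mem_univ, true_and] at h
    by_cases ha : c a = j
    · simp [ha, h.1]
    · simp [ha, h.1.not_gt]
  · rintro ⟨a, b⟩ h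
    simp only [colorSet, Finset.mem_sigma, Finset.mem_filter, Finset.mem_univ, true_and] at h
    have hne := c.valid h.2
    have hb : c b ≠ j := fun hb => hne (h.1.trans hb.symm)
    by_cases hab : a < b
    · simp [hab, h.1]
    · simp [hab, hb]
  · rintro ⟨a, b⟩ h
    by_cases ha : c a = j
    · simp [ha]
    · simp [ha, and_comm]

theorem outcomeSign_eq_or (b : Bool) : outcomeSign b = 1 ∨ outcomeSign b = -1 := by
  cases b <;> simp [outcomeSign]

theorem prod_outcomeSign_eq_or {ι : Type*} (s : Finset ι) (f : ι → Bool) :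
    ∏ k ∈ s, outcomeSign (f k) = 1 ∨ ∏ k ∈ s, outcomeSign (f k) = -1 := by
  classical
  induction s using Finset.induction_on with
  | empty => simp
  | insert a s ha ih =>
    rw [Finset.prod_insert ha]
    rcases ih with h | h <;> rcases outcomeSign_eq_or (f a) with h' | h' <;> simp [h, h']

open scoped Classical in
theorem failBit_eq_false_iff (c : G.Coloring (Fin 2)) (j : Fin 2) (o : Qubits n) :
    failBit c j o = false ↔ ∀ i ∈ colorSet c j,
      outcomeSign (o i) = ∏ k ∈ Finset.univ.filter (fun k => G.Adj i k), outcomeSign (o k) := by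
  unfold failBit passValue
  rw [decide_eq_false_iff_not, Finset.prod_eq_zero_iff]
  push Not
  refine forall₂_congr fun i _ => ?_
  rcases outcomeSign_eq_or (o i) with h | h <;>
    rcases prod_outcomeSign_eq_or (Finset.univ.filter (fun k => G.Adj i k)) o with h' | h' <;>
    rw [h, h'] <;> norm_num

/-- Neighbours of a vertex of colour `j` lie outside the colour class, where `o` and `x` agree.
Passing fixes the sign of each X result as a product of neighbouring Z signs, so the X amplitudes
reproduce the controlled-Z signs edge by edge. -/
theorem outcomeVec_of_pass (c : G.Coloring (Fin 2)) (j : Fin 2) (o x : Qubits n)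
    (ho : failBit c j o = false) :
    outcomeVec (colorSet c j) o x = if ∀ i ∉ colorSet c j, o i = x i
      then invSqrtTwo ^ (colorSet c j).card * graphSign G x else 0 := by
  classical
  split_ifs with h
  · rw [graphSign_eq_prod_colorSet c j, ← Finset.prod_const, ← Finset.prod_mul_distrib,
      outcomeVec, ← Finset.prod_subset (Finset.subset_univ (colorSet c j))]
    · refine Finset.prod_congr rfl fun i hi => ?_
      have h1 := (failBit_eq_false_iff c j o).1 ho i hi
      have h2 : ∏ k ∈ Finset.univ.filter (fun k => G.Adj i k), outcomeSign (o k)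
          = ∏ k ∈ Finset.univ.filter (fun k => G.Adj i k), outcomeSign (x k) := by
        refine Finset.prod_congr rfl fun k hk => ?_
        rw [h k]
        intro hk'
        simp only [colorSet, Finset.mem_filter, Finset.mem_univ, true_and] at hk hk' hi
        exact c.valid hk (hi.trans hk'.symm)
      rw [h2] at h1
      have h3 := congrArg (fun r : ℝ => (r : ℂ)) h1
      simp only [outcomeSign, Complex.ofReal_prod] at h3
      rw [if_pos hi, xVec]
      cases hx : x i
      · simp
      · simp only [true_and]
        have h4 : ∀ k, (if x k = true then (-1 : ℂ) else 1)
          = ((if x k = true then (-1 : ℝ) else 1 : ℝ) : ℂ) := by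
          intro k; split_ifs <;> simp
        simp only [h4]
        rw [← h3]
        split_ifs <;> simp
    · intro i _ hi
      simp [hi, zVec, h i hi]
  · push Not at h
    obtain ⟨i, hi, hne⟩ := h
    exact Finset.prod_eq_zero (Finset.mem_univ i) (by simp [hi, zVec, hne.symm])

theorem bitOp_false_apply (c : G.Coloring (Fin 2)) (j : Fin 2) (x y : Qubits n) :
    bitOp c j false x y = if ∀ i ∉ colorSet c j, x i = y i
      then (invSqrtTwo ^ (colorSet c j).card) ^ 2 * (graphSign G x * graphSign G y) else 0 := by
  classical
  -- The only passing record compatible with `x` outside the colour class: its X results are forced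
  -- by the neighbours. The sum defining `bitOp` thus has at most one nonzero term.
  let o₀ : Qubits n := fun i => if i ∈ colorSet c j then
    decide (∏ k ∈ Finset.univ.filter (fun k => G.Adj i k), outcomeSign (x k) = -1) else x i
  have hN : ∀ i ∈ colorSet c j, ∀ k, G.Adj i k → k ∉ colorSet c j := by
    intro i hi k hk hk'
    simp only [colorSet, Finset.mem_filter, Finset.mem_univ, true_and] at hk' hi
    exact c.valid hk (hi.trans hk'.symm)
  have hcong : ∀ o : Qubits n, (∀ i ∉ colorSet c j, o i = x i) → ∀ i ∈ colorSet c j,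
      ∏ k ∈ Finset.univ.filter (fun k => G.Adj i k), outcomeSign (o k)
        = ∏ k ∈ Finset.univ.filter (fun k => G.Adj i k), outcomeSign (x k) := by
    intro o ho i hi
    refine Finset.prod_congr rfl fun k hk => ?_
    rw [ho k (hN i hi k (Finset.mem_filter.1 hk).2)]
  have key : ∀ o, (failBit c j o = false ∧ ∀ i ∉ colorSet c j, o i = x i) ↔ o = o₀ := by
    intro o
    constructor
    · rintro ⟨h1, h2⟩
      funext i
      by_cases hi : i ∈ colorSet c j
      · have h3 := (failBit_eq_false_iff c j o).1 h1 i hi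
        rw [hcong o h2 i hi] at h3
        simp only [o₀, hi, if_true, ← h3]
        cases o i <;> simp [outcomeSign]; norm_num
      · simp [o₀, hi, h2 i hi]
    · rintro rfl
      have h2 : ∀ i ∉ colorSet c j, o₀ i = x i := fun i hi => by simp [o₀, hi]
      refine ⟨(failBit_eq_false_iff c j _).2 fun i hi => ?_, h2⟩
      rw [hcong o₀ h2 i hi]
      rcases prod_outcomeSign_eq_or (Finset.univ.filter (fun k => G.Adj i k)) x with h | h
      · simp only [o₀, hi, if_true, h]; norm_num [outcomeSign]
      · simp only [o₀, hi, if_true, h]; norm_num [outcomeSign]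
  have hterm : ∀ o, (if failBit c j o = false then outcomeProj (colorSet c j) o else 0) x y
      = if o = o₀ then (if ∀ i ∉ colorSet c j, x i = y i
      then (invSqrtTwo ^ (colorSet c j).card) ^ 2 * (graphSign G x * graphSign G y) else 0)
        else 0 := by
    intro o
    by_cases ho : failBit c j o = false
    · rw [if_pos ho, outcomeProj_apply, outcomeVec_of_pass c j o x ho,
        outcomeVec_of_pass c j o y ho]
      by_cases hx : ∀ i ∉ colorSet c j, o i = x i
      · rw [if_pos hx, if_pos ((key o).1 ⟨ho, hx⟩)]
        have : (∀ i ∉ colorSet c j, o i = y i) ↔ ∀ i ∉ colorSet c j, x i = y i :=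
          forall₂_congr fun i hi => by rw [hx i hi]
        simp only [this]
        split_ifs
        · ring
        · simp
      · rw [if_neg hx, if_neg fun h => hx ((key o).2 h).2, zero_mul]
    · rw [if_neg ho, if_neg fun h => ho ((key o).2 h).1]
      rfl
  rw [bitOp, Matrix.sum_apply, Finset.sum_congr rfl fun o _ => hterm o]
  simp

theorem bitOp_zero_mul_bitOp_one (c : G.Coloring (Fin 2)) :
    bitOp c 0 false * bitOp c 1 false
      = Matrix.vecMulVec (graphState G) (star (graphState G)) := by
  classical
  ext x y
  have hmem : ∀ i, i ∉ colorSet c 1 ↔ i ∈ colorSet c 0 := by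
    intro i
    simp only [colorSet, Finset.mem_filter, Finset.mem_univ, true_and]
    omega
  have hcompl : colorSet c 1 = (colorSet c 0)ᶜ := by
    ext i; rw [Finset.mem_compl, ← hmem i, not_not]
  have hcard : (colorSet c 0).card + (colorSet c 1).card = n := by
    rw [hcompl, Finset.card_add_card_compl, Fintype.card_fin]
  -- The first factor fixes the intermediate label on colour 1 and the second fixes it on colour 0.
  -- Only `z₀` survives, and its sign appears squared.
  let z₀ : Qubits n := fun i => if i ∈ colorSet c 0 then y i else x i
  rw [Matrix.mul_apply, Finset.sum_eq_single z₀]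
  · have h1 : ∀ i ∉ colorSet c 0, x i = z₀ i := fun i hi => by simp [z₀, hi]
    have h2 : ∀ i ∉ colorSet c 1, z₀ i = y i := fun i hi => by simp [z₀, (hmem i).1 hi]
    rw [bitOp_false_apply, bitOp_false_apply, if_pos h1, if_pos h2, Matrix.vecMulVec_apply,
      Pi.star_apply, graphState_apply, graphState_apply, star_mul', star_graphSign, star_pow,
      star_invSqrtTwo]
    have := graphSign_mul_self (G := G) z₀
    have hpow : invSqrtTwo ^ n
        = invSqrtTwo ^ (colorSet c 0).card * invSqrtTwo ^ (colorSet c 1).card := by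
      rw [← pow_add, hcard]
    rw [hpow]
    linear_combination ((invSqrtTwo ^ (colorSet c 0).card) * (invSqrtTwo ^ (colorSet c 1).card)) ^ 2
      * graphSign G x * graphSign G y * this
  · intro z _ hz
    rw [bitOp_false_apply, bitOp_false_apply]
    by_cases h1 : ∀ i ∉ colorSet c 0, x i = z i
    · have h2 : ¬ ∀ i ∉ colorSet c 1, z i = y i := by
        intro h2
        apply hz
        funext i
        by_cases hi : i ∈ colorSet c 0
        · simp [z₀, hi, h2 i ((hmem i).2 hi)]
        · simp [z₀, hi, h1 i hi]
      rw [if_neg h2, mul_zero]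
    · rw [if_neg h1, zero_mul]
  · simp

open scoped ComplexOrder in
/-- The infidelity operator is at most the sum of the two fail projectors. -/
theorem posSemidef_union_bound (c : G.Coloring (Fin 2)) :
    (bitOp c 0 true + bitOp c 1 true
      + Matrix.vecMulVec (graphState G) (star (graphState G)) - 1).PosSemidef := by
  have hg := bitOp_zero_mul_bitOp_one c
  have hgH : bitOp c 1 false * bitOp c 0 false
      = Matrix.vecMulVec (graphState G) (star (graphState G)) := by
    have h := congrArg Matrix.conjTranspose hg
    rw [Matrix.conjTranspose_mul, (posSemidef_bitOp c 0 false).1.eq,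
      (posSemidef_bitOp c 1 false).1.eq] at h
    rw [h, (Matrix.posSemidef_vecMulVec_self_star _).1.eq]
  have h0 : bitOp c 0 false = 1 - bitOp c 0 true := by
    rw [← sum_bitOp c 0, Fintype.sum_bool]; abel
  have h1 : bitOp c 1 false = 1 - bitOp c 1 true := by
    rw [← sum_bitOp c 1, Fintype.sum_bool]; abel
  have i0 := bitOp_mul_self c 0 true
  have i1 := bitOp_mul_self c 1 true
  -- Both orders of the product of pass projectors equal |G⟩⟨G|, so the complementary fail
  -- projectors commute too.
  have hcomm : bitOp c 0 true * bitOp c 1 true = bitOp c 1 true * bitOp c 0 true := by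
    have h := hg.trans hgH.symm
    rw [h0, h1, ← sub_eq_zero] at h
    rw [← sub_eq_zero, ← h]
    noncomm_ring
  -- Inclusion-exclusion: the operator is the product of the two commuting fail projectors, hence a
  -- projector, written as X†X to show positivity.
  have he : bitOp c 0 true + bitOp c 1 true
      + Matrix.vecMulVec (graphState G) (star (graphState G)) - 1
      = Matrix.conjTranspose (bitOp c 1 true * bitOp c 0 true)
        * (bitOp c 1 true * bitOp c 0 true) := by
    rw [Matrix.conjTranspose_mul, (posSemidef_bitOp c 0 true).1.eq,
      (posSemidef_bitOp c 1 true).1.eq, ← hg, h0, h1]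
    have : bitOp c 0 true * bitOp c 1 true * (bitOp c 1 true * bitOp c 0 true)
        = bitOp c 0 true * bitOp c 1 true := by
      rw [mul_assoc, ← mul_assoc (bitOp c 1 true), i1, ← hcomm, ← mul_assoc, i0]
    rw [this]
    noncomm_ring
  rw [he]
  exact Matrix.posSemidef_conjTranspose_mul_self _

end

end PVBQC
namespace PVBQC

/-! ### Local operators on the joint space -/

noncomputable section

variable {N n : ℕ}

theorem tensorOp_mul (A B : Fin N → Matrix (Qubits n) (Qubits n) ℂ) :
    tensorOp A * tensorOp B = tensorOp fun k => A k * B k := by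
  ext x y
  simp only [Matrix.mul_apply, tensorOp, ← Finset.prod_mul_distrib]
  rw [Finset.prod_univ_sum (fun _ => Finset.univ), Fintype.piFinset_univ]

theorem tensorOp_one : tensorOp (fun _ : Fin N => (1 : Matrix (Qubits n) (Qubits n) ℂ)) = 1 := by
  ext x y
  simp only [tensorOp, Matrix.one_apply]
  by_cases h : x = y
  · simp [h]
  · obtain ⟨i, hi⟩ := Function.ne_iff.1 h
    rw [if_neg h]
    exact Finset.prod_eq_zero (Finset.mem_univ i) (if_neg hi)

theorem conjTranspose_tensorOp (A : Fin N → Matrix (Qubits n) (Qubits n) ℂ) :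
    (tensorOp A).conjTranspose = tensorOp fun k => (A k).conjTranspose := by
  ext x y
  simp [tensorOp, Matrix.conjTranspose_apply]

theorem sum_tensorOp {X : Type*} [Fintype X] (p : Fin N → Prop) [DecidablePred p]
    (D : Fin N → X → Matrix (Qubits n) (Qubits n) ℂ)
    (C : Fin N → Matrix (Qubits n) (Qubits n) ℂ) :
    ∑ f : {k // p k} → X, tensorOp (fun k => if h : p k then D k (f ⟨k, h⟩) else C k)
      = tensorOp fun k => if p k then ∑ x, D k x else C k := by
  classical
  ext x y
  rw [Matrix.sum_apply]
  simp only [tensorOp]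
  have h1 : ∀ f : {k // p k} → X,
      ∏ k, (if h : p k then D k (f ⟨k, h⟩) else C k) (x k) (y k)
        = (∏ k : {k // p k}, D k (f k) (x k) (y k)) * ∏ k : {k // ¬ p k}, C k (x k) (y k) := by
    intro f
    rw [← Fintype.prod_dite (fun k h => D k (f ⟨k, h⟩) (x k) (y k)) fun k _ => C k (x k) (y k)]
    refine Finset.prod_congr rfl fun k _ => ?_
    split_ifs <;> rfl
  have h2 : ∏ k, (if p k then ∑ x, D k x else C k) (x k) (y k)
      = (∏ k : {k // p k}, ∑ b, D k b (x k) (y k)) * ∏ k : {k // ¬ p k}, C k (x k) (y k) := by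
    rw [← Fintype.prod_dite (fun k _ => ∑ b, D k b (x k) (y k)) fun k _ => C k (x k) (y k)]
    refine Finset.prod_congr rfl fun k _ => ?_
    split_ifs
    · rw [Matrix.sum_apply]
    · rfl
  rw [h2, Finset.prod_univ_sum (fun _ => Finset.univ), Fintype.piFinset_univ, Finset.sum_mul]
  exact Finset.sum_congr rfl fun f _ => h1 f

theorem tensorOp_dite_smul {X : Type*} (p : Fin N → Prop) [DecidablePred p] (u : Fin N → X → ℂ)
    (D : Fin N → X → Matrix (Qubits n) (Qubits n) ℂ)
    (C : Fin N → Matrix (Qubits n) (Qubits n) ℂ) (f : {k // p k} → X) :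
    tensorOp (fun k => if h : p k then u k (f ⟨k, h⟩) • D k (f ⟨k, h⟩) else C k)
      = (∏ k : {k // p k}, u k (f k)) •
        tensorOp fun k => if h : p k then D k (f ⟨k, h⟩) else C k := by
  ext x y
  have hu : ∏ k : {k // p k}, u k (f k) = ∏ k, if h : p k then u k (f ⟨k, h⟩) else 1 := by
    rw [Fintype.prod_dite]; simp
  rw [Matrix.smul_apply, hu, smul_eq_mul]
  simp only [tensorOp]
  rw [← Finset.prod_mul_distrib]
  refine Finset.prod_congr rfl fun k _ => ?_
  split_ifs <;> simp

/-- The expectation value in the state `σ` of the product of the local operators `A k`. -/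
def localExpect (σ : Matrix (Registers N n) (Registers N n) ℂ)
    (A : Fin N → Matrix (Qubits n) (Qubits n) ℂ) : ℝ :=
  (σ * tensorOp A).trace.re

/-- Distributivity of the tensor product: a weight that factors over registers can be summed inside
each local operator. This moves exponentials of failure counts under the trace. -/
theorem sum_localExpect {X : Type*} [Fintype X] (σ : Matrix (Registers N n) (Registers N n) ℂ)
    (p : Fin N → Prop) [DecidablePred p] (u : Fin N → X → ℝ)
    (D : Fin N → X → Matrix (Qubits n) (Qubits n) ℂ)
    (C : Fin N → Matrix (Qubits n) (Qubits n) ℂ) :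
    ∑ f : {k // p k} → X, (∏ k : {k // p k}, u k (f k)) *
        localExpect σ (fun k => if h : p k then D k (f ⟨k, h⟩) else C k)
      = localExpect σ fun k => if p k then ∑ x, (u k x : ℂ) • D k x else C k := by
  unfold localExpect
  rw [← sum_tensorOp p (fun k x => (u k x : ℂ) • D k x) C, Finset.mul_sum, Matrix.trace_sum,
    Complex.re_sum]
  refine Finset.sum_congr rfl fun f _ => ?_
  rw [tensorOp_dite_smul p (fun k x => (u k x : ℂ)) D C f, Matrix.mul_smul, Matrix.trace_smul,
    ← Complex.ofReal_prod, smul_eq_mul, Complex.re_ofReal_mul]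

theorem sum_localExpect_mem {X : Type*} [Fintype X]
    (σ : Matrix (Registers N n) (Registers N n) ℂ) (S : Finset (Fin N)) (u : Fin N → X → ℝ)
    (D : Fin N → X → Matrix (Qubits n) (Qubits n) ℂ)
    (C : Fin N → Matrix (Qubits n) (Qubits n) ℂ) :
    ∑ f : {k // k ∈ S} → X, (∏ k : {k // k ∈ S}, u k (f k)) *
        localExpect σ (fun k => if h : k ∈ S then D k (f ⟨k, h⟩) else C k)
      = localExpect σ fun k => if k ∈ S then ∑ x, (u k x : ℂ) • D k x else C k := by
  convert sum_localExpect σ (fun k => k ∈ S) u D C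

theorem sum_localExpect_univ {X : Type*} [Fintype X]
    (σ : Matrix (Registers N n) (Registers N n) ℂ) (u : Fin N → X → ℝ)
    (D : Fin N → X → Matrix (Qubits n) (Qubits n) ℂ) :
    ∑ z : Fin N → X, (∏ k, u k (z k)) * localExpect σ (fun k => D k (z k))
      = localExpect σ fun k => ∑ x, (u k x : ℂ) • D k x := by
  classical
  have h := sum_localExpect σ (fun _ => True) u D fun _ => 0
  simp only [if_true, dite_true] at h
  rw [← h]
  let e : Fin N ≃ {k : Fin N // True} := (Equiv.subtypeUnivEquiv fun _ => trivial).symm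
  refine Fintype.sum_equiv (Equiv.arrowCongr e (Equiv.refl X)) _ _ fun z => ?_
  congr 1
  exact Fintype.prod_equiv e _ _ fun k => rfl

-- Factoring each `A k` as B†B factors the whole tensor product, and cyclicity leaves the trace of a
-- positive conjugate of `σ`.
open scoped ComplexOrder MatrixOrder Matrix.Norms.L2Operator in
theorem localExpect_nonneg {σ : Matrix (Registers N n) (Registers N n) ℂ} (hσ : σ.PosSemidef)
    (A : Fin N → Matrix (Qubits n) (Qubits n) ℂ) (hA : ∀ k, (A k).PosSemidef) :
    0 ≤ localExpect σ A := by
  choose B hB using fun k => CStarAlgebra.nonneg_iff_eq_star_mul_self.1 (hA k).nonneg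
  have h : tensorOp A = (tensorOp B).conjTranspose * tensorOp B := by
    rw [conjTranspose_tensorOp, tensorOp_mul]
    exact congrArg tensorOp (funext hB)
  rw [localExpect, h, ← mul_assoc, Matrix.trace_mul_comm, ← mul_assoc]
  have := (hσ.mul_mul_conjTranspose_same (tensorOp B)).trace_nonneg
  exact (Complex.le_def.1 this).1

theorem localExpect_one {σ : Matrix (Registers N n) (Registers N n) ℂ} (hσ : σ.trace = 1) :
    localExpect σ (fun _ => 1) = 1 := by
  rw [localExpect, tensorOp_one, mul_one, hσ, Complex.one_re]

theorem tensorOp_update_apply (A : Fin N → Matrix (Qubits n) (Qubits n) ℂ) (r : Fin N)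
    (X : Matrix (Qubits n) (Qubits n) ℂ) (x y : Registers N n) :
    tensorOp (Function.update A r X) x y
      = X (x r) (y r) * ∏ k ∈ Finset.univ.erase r, A k (x k) (y k) := by
  rw [tensorOp, ← Finset.mul_prod_erase _ _ (Finset.mem_univ r), Function.update_self]
  congr 1
  refine Finset.prod_congr rfl fun k hk => ?_
  rw [Function.update_of_ne (Finset.ne_of_mem_erase hk)]

theorem localExpect_update_add (σ : Matrix (Registers N n) (Registers N n) ℂ)
    (A : Fin N → Matrix (Qubits n) (Qubits n) ℂ) (r : Fin N)
    (X Y : Matrix (Qubits n) (Qubits n) ℂ) :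
    localExpect σ (Function.update A r (X + Y))
      = localExpect σ (Function.update A r X) + localExpect σ (Function.update A r Y) := by
  have h : tensorOp (Function.update A r (X + Y))
      = tensorOp (Function.update A r X) + tensorOp (Function.update A r Y) := by
    ext x y
    rw [Matrix.add_apply]
    simp only [tensorOp_update_apply, Matrix.add_apply, add_mul]
  rw [localExpect, h, mul_add, Matrix.trace_add, Complex.add_re]
  rfl

/-- The identity factors force the two labels to agree away from `r`, which is exactly the partial
trace. -/
theorem fidelity_reducedState (ρ : Matrix (Registers N n) (Registers N n) ℂ) (r : Fin N)
    (ψ : Qubits n → ℂ) :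
    fidelity ψ (reducedState ρ r)
      = localExpect ρ (Function.update (fun _ => 1) r (Matrix.vecMulVec ψ (star ψ))) := by
  unfold fidelity localExpect
  congr 1
  have h1 : ∀ z w : Registers N n,
      tensorOp (Function.update (fun _ => 1) r (Matrix.vecMulVec ψ (star ψ))) w z
        = if w = Function.update z r (w r) then ψ (w r) * star (ψ (z r)) else 0 := by
    intro z w
    rw [tensorOp_update_apply, Matrix.vecMulVec_apply, Pi.star_apply]
    split_ifs with h
    · rw [Finset.prod_eq_one, mul_one]
      intro k hk
      rw [h, Function.update_of_ne (Finset.ne_of_mem_erase hk), Matrix.one_apply_eq]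
    · obtain ⟨k, hk⟩ := Function.ne_iff.1 h
      have hkr : k ≠ r := by rintro rfl; simp at hk
      rw [Function.update_of_ne hkr] at hk
      rw [Finset.prod_eq_zero (Finset.mem_erase.2 ⟨hkr, Finset.mem_univ k⟩), mul_zero]
      exact Matrix.one_apply_ne hk
  have h2 : ∀ z : Registers N n, ∑ w : Registers N n, ρ z w *
      tensorOp (Function.update (fun _ => 1) r (Matrix.vecMulVec ψ (star ψ))) w z
        = ∑ y, star (ψ (z r)) * (ρ z (Function.update z r y) * ψ y) := by
    intro z
    symm
    refine Finset.sum_of_injOn (fun y => Function.update z r y)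
      (Function.update_injective z r).injOn (fun _ _ => Finset.mem_univ _) ?_ ?_
    · intro w _ hw
      rw [h1, if_neg, mul_zero]
      intro h
      exact hw ⟨w r, Finset.mem_coe.2 (Finset.mem_univ _), h.symm⟩
    · intro y _
      rw [h1]
      simp only [Function.update_self, if_true]
      ring
  simp only [Matrix.trace, Matrix.diag_apply, Matrix.mul_apply, h2]
  simp only [dotProduct, Matrix.mulVec, reducedState, Finset.mul_sum, Finset.sum_mul, ite_mul,
    mul_ite, zero_mul, mul_zero, Pi.star_apply]
  rw [Finset.sum_congr rfl fun x _ => Finset.sum_comm, Finset.sum_comm]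
  refine Finset.sum_congr rfl fun z _ => ?_
  rw [Finset.sum_comm]
  refine Finset.sum_congr rfl fun y _ => ?_
  simp

theorem fidelity_smul_sum {ι κ : Type*} [Fintype ι] (ψ : ι → ℂ) (a : ℝ) (s : Finset κ)
    (ρ : κ → Matrix ι ι ℂ) :
    fidelity ψ ((a : ℂ) • ∑ r ∈ s, ρ r) = a * ∑ r ∈ s, fidelity ψ (ρ r) := by
  unfold fidelity
  rw [Matrix.smul_mulVec, dotProduct_smul, Matrix.sum_mulVec, dotProduct_sum, smul_eq_mul,
    Complex.re_ofReal_mul, Complex.re_sum]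

end

end PVBQC
namespace PVBQC

/-! ### Exponential moments of the failure counts -/

noncomputable section

variable {N n : ℕ} {G : SimpleGraph (Fin n)}

/-- The local factors of `recordProj`. -/
def recordFactor (c : G.Coloring (Fin 2)) (A B : Finset (Fin N)) (o : MeasRecord n A B) :
    Fin N → Matrix (Qubits n) (Qubits n) ℂ := fun k =>
  if h : k ∈ A ∪ B then outcomeProj (colorSet c (if k ∈ A then 0 else 1)) (o ⟨k, h⟩) else 1

theorem recordProj_eq (c : G.Coloring (Fin 2)) (A B : Finset (Fin N)) (o : MeasRecord n A B) :
    recordProj c A B o = tensorOp (recordFactor c A B o) := rfl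

theorem recordFactor_of_notMem (c : G.Coloring (Fin 2)) {A B : Finset (Fin N)}
    (o : MeasRecord n A B) {k : Fin N} (hk : k ∉ A ∪ B) : recordFactor c A B o k = 1 :=
  dif_neg hk

open scoped ComplexOrder in
theorem posSemidef_recordFactor (c : G.Coloring (Fin 2)) (A B : Finset (Fin N))
    (o : MeasRecord n A B) (k : Fin N) : (recordFactor c A B o k).PosSemidef := by
  unfold recordFactor
  split_ifs
  · exact posSemidef_outcomeProj _ _
  · exact posSemidef_outcomeProj _ _
  · exact Matrix.PosSemidef.one

theorem recordFactor_mul_self (c : G.Coloring (Fin 2)) (A B : Finset (Fin N))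
    (o : MeasRecord n A B) (k : Fin N) :
    recordFactor c A B o k * recordFactor c A B o k = recordFactor c A B o k := by
  unfold recordFactor
  by_cases h : k ∈ A ∪ B
  · simp only [h, dite_true, outcomeProj_mul, if_true]
  · simp only [h, dite_false, mul_one]

theorem bornProb_eq (c : G.Coloring (Fin 2)) (σ : Matrix (Registers N n) (Registers N n) ℂ)
    (A B : Finset (Fin N)) (o : MeasRecord n A B) :
    bornProb c σ A B o = localExpect σ (recordFactor c A B o) := by
  rw [bornProb, collapsed, recordProj_eq, Matrix.trace_mul_comm, ← mul_assoc, tensorOp_mul,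
    Matrix.trace_mul_comm, localExpect]
  simp only [recordFactor_mul_self]

/-- Cyclicity brings both record projectors next to `X`. They are the identity at the unmeasured
register `r` and idempotent elsewhere. -/
theorem localExpect_collapsed (c : G.Coloring (Fin 2))
    (σ : Matrix (Registers N n) (Registers N n) ℂ) (A B : Finset (Fin N)) (o : MeasRecord n A B)
    {r : Fin N} (hr : r ∉ A ∪ B) (X : Matrix (Qubits n) (Qubits n) ℂ) :
    localExpect (collapsed c σ A B o) (Function.update (fun _ => 1) r X)
      = localExpect σ (Function.update (recordFactor c A B o) r X) := by
  rw [localExpect, collapsed, recordProj_eq, mul_assoc, mul_assoc, Matrix.trace_mul_comm, mul_assoc,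
    tensorOp_mul, tensorOp_mul, localExpect]
  congr 4
  funext k
  by_cases hk : k = r
  · subst hk
    simp [recordFactor_of_notMem c o hr]
  · simp [Function.update_of_ne hk, recordFactor_mul_self]

theorem localExpect_smul (a : ℝ) (σ : Matrix (Registers N n) (Registers N n) ℂ)
    (A : Fin N → Matrix (Qubits n) (Qubits n) ℂ) :
    localExpect ((a : ℂ) • σ) A = a * localExpect σ A := by
  rw [localExpect, Matrix.smul_mul, Matrix.trace_smul, smul_eq_mul, Complex.re_ofReal_mul,
    localExpect]

theorem restFidelity_eq (c : G.Coloring (Fin 2)) (σ : Matrix (Registers N n) (Registers N n) ℂ)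
    (A B R : Finset (Fin N)) (hR : ∀ r ∈ R, r ∉ A ∪ B) (o : MeasRecord n A B) :
    restFidelity c σ A B R o = (R.card : ℝ)⁻¹ * ∑ r ∈ R, (bornProb c σ A B o)⁻¹ *
      localExpect σ (Function.update (recordFactor c A B o) r
        (Matrix.vecMulVec (graphState G) (star (graphState G)))) := by
  have h : ((R.card : ℂ)⁻¹) = (((R.card : ℝ)⁻¹ : ℝ) : ℂ) := by push_cast; rfl
  rw [restFidelity, h, fidelity_smul_sum]
  congr 1
  refine Finset.sum_congr rfl fun r hr => ?_
  rw [fidelity_reducedState, postState, ← Complex.ofReal_inv, localExpect_smul,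
    localExpect_collapsed c σ A B o (hR r hr)]

/-- The mean, over the registers in `R`, of the probability to fail test `j` given `o`. -/
def restFail (c : G.Coloring (Fin 2)) (σ : Matrix (Registers N n) (Registers N n) ℂ)
    (A B R : Finset (Fin N)) (o : MeasRecord n A B) (j : Fin 2) : ℝ :=
  (∑ r ∈ R, localExpect σ (Function.update (recordFactor c A B o) r (bitOp c j true))) / R.card
    / bornProb c σ A B o

open scoped ComplexOrder in
theorem one_sub_restFidelity_le (c : G.Coloring (Fin 2))
    {σ : Matrix (Registers N n) (Registers N n) ℂ} (hσ : σ.PosSemidef)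
    (A B R : Finset (Fin N)) (hR : ∀ r ∈ R, r ∉ A ∪ B) (hR0 : 0 < R.card) (o : MeasRecord n A B)
    (ho : 0 < bornProb c σ A B o) :
    1 - restFidelity c σ A B R o ≤ restFail c σ A B R o 0 + restFail c σ A B R o 1 := by
  have hR0' : (0 : ℝ) < R.card := by exact_mod_cast hR0
  rw [restFidelity_eq c σ A B R hR]
  have key : ∀ r ∈ R, bornProb c σ A B o ≤
      localExpect σ (Function.update (recordFactor c A B o) r (bitOp c 0 true))
      + localExpect σ (Function.update (recordFactor c A B o) r (bitOp c 1 true))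
      + localExpect σ (Function.update (recordFactor c A B o) r
        (Matrix.vecMulVec (graphState G) (star (graphState G)))) := by
    intro r hr
    rw [← localExpect_update_add, ← localExpect_update_add,
      ← sub_add_cancel (bitOp c 0 true + bitOp c 1 true
        + Matrix.vecMulVec (graphState G) (star (graphState G))) 1, localExpect_update_add]
    -- The factor at the unmeasured register is already the identity, so the constant term of the
    -- operator inequality yields the Born probability.
    have h1 : Function.update (recordFactor c A B o) r 1 = recordFactor c A B o := by
      rw [← recordFactor_of_notMem c o (hR r hr), Function.update_eq_self]
    rw [h1, ← bornProb_eq]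
    refine le_add_of_nonneg_left (localExpect_nonneg hσ _ fun k => ?_)
    by_cases hk : k = r
    · subst hk
      rw [Function.update_self]
      exact posSemidef_union_bound c
    · rw [Function.update_of_ne hk]
      exact posSemidef_recordFactor c A B o k
  have hsum := Finset.sum_le_sum key
  rw [Finset.sum_const, nsmul_eq_mul, Finset.sum_add_distrib, Finset.sum_add_distrib] at hsum
  unfold restFail
  rw [← Finset.mul_sum, ← add_div, ← add_div, sub_le_iff_le_add, div_div, ← mul_assoc,
    ← mul_inv, ← div_eq_inv_mul, ← add_div, one_le_div (by positivity)]
  exact hsum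

/-! ### Comparison with the same test on every register -/

/-- The number `0` or `1` of a bit. -/
def bitVal (b : Bool) : ℝ := if b = true then 1 else 0

theorem abs_bitVal_sub_le (a b : Bool) : |bitVal a - bitVal b| ≤ 1 := by
  cases a <;> cases b <;> simp [bitVal]

/-- The mean of `x` over `R` minus its mean over `T`. -/
def avgDiff {α : Type*} (x : α → ℝ) (R T : Finset α) : ℝ :=
  (∑ r ∈ R, x r) / R.card - (∑ a ∈ T, x a) / T.card

/-- The exponential moment of the difference between the fraction of registers in `R` and that of
registers in `T` that fail test `j`, when all registers undergo that test. -/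
def failMoment (c : G.Coloring (Fin 2)) (σ : Matrix (Registers N n) (Registers N n) ℂ) (j : Fin 2)
    (t : ℝ) (R T : Finset (Fin N)) : ℝ :=
  ∑ z : Fin N → Bool, localExpect σ (fun k => bitOp c j (z k)) *
    Real.exp (t * avgDiff (fun k => bitVal (z k)) R T)

theorem sum_localExpect_bitOp {σ : Matrix (Registers N n) (Registers N n) ℂ} (hσ : σ.trace = 1)
    (c : G.Coloring (Fin 2)) (j : Fin 2) :
    ∑ z : Fin N → Bool, localExpect σ (fun k => bitOp c j (z k)) = 1 := by
  have h := sum_localExpect_univ σ (fun _ _ => 1) (fun _ b => bitOp c j b)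
  simp only [Finset.prod_const_one, one_mul, Complex.ofReal_one, one_smul, sum_bitOp] at h
  rw [h, localExpect_one hσ]

/-- Jensen for exp with unnormalised weights, through the tangent line at the weighted mean. -/
theorem mul_exp_div_le_sum {ι : Type*} (s : Finset ι) (J X : ι → ℝ) (hJ : ∀ i ∈ s, 0 ≤ J i)
    {w : ℝ} (hw : 0 < w) (hJw : ∑ i ∈ s, J i = w) :
    w * Real.exp ((∑ i ∈ s, J i * X i) / w) ≤ ∑ i ∈ s, J i * Real.exp (X i) := by
  set m := (∑ i ∈ s, J i * X i) / w with hm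
  have hmw : ∑ i ∈ s, J i * X i = m * w := by rw [hm, div_mul_cancel₀ _ hw.ne']
  calc w * Real.exp m = ∑ i ∈ s, J i * (Real.exp m * (X i - m + 1)) := by
        have : ∀ i, J i * (Real.exp m * (X i - m + 1))
          = Real.exp m * (J i * X i) - Real.exp m * m * J i + Real.exp m * J i := fun i => by ring
        simp only [this, Finset.sum_add_distrib, Finset.sum_sub_distrib, ← Finset.mul_sum, hmw, hJw]
        ring
    _ ≤ _ := by
        refine Finset.sum_le_sum fun i hi => mul_le_mul_of_nonneg_left ?_ (hJ i hi)
        calc Real.exp m * (X i - m + 1) ≤ Real.exp m * Real.exp (X i - m) :=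
              mul_le_mul_of_nonneg_left (Real.add_one_le_exp _) (Real.exp_pos _).le
          _ = Real.exp (X i) := by rw [← Real.exp_add]; congr 1; ring

theorem prod_subtype_ite_mem {α M : Type*} [Fintype α] [DecidableEq α] [CommMonoid M]
    (p : α → Prop) [DecidablePred p] (R : Finset α) (hR : ∀ r ∈ R, p r) (F : α → M) :
    ∏ k : {k // p k}, (if (k : α) ∈ R then F k else 1) = ∏ r ∈ R, F r := by
  rw [← Finset.prod_subtype (Finset.univ.filter p) (by simp) fun k => if k ∈ R then F k else 1,
    Finset.prod_ite_mem]
  congr 1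
  ext k
  simpa using hR k

-- Imagine test `j` on every unmeasured register. Given `o`, `restFail` is the mean failure fraction
-- on `R`, so Jensen passes from the exponential of the mean to the mean of the exponential, which
-- factors over registers.
open scoped ComplexOrder in
theorem bornProb_mul_exp_restFail_le (c : G.Coloring (Fin 2))
    {σ : Matrix (Registers N n) (Registers N n) ℂ} (hσ : σ.PosSemidef)
    (A B R : Finset (Fin N)) (hR : ∀ r ∈ R, r ∉ A ∪ B) (o : MeasRecord n A B) (j : Fin 2) (t : ℝ) :
    bornProb c σ A B o * Real.exp (t * restFail c σ A B R o j) ≤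
      localExpect σ fun k => if k ∉ A ∪ B then
        ∑ b, ((if k ∈ R then Real.exp (t / R.card * bitVal b) else 1 : ℝ) : ℂ) • bitOp c j b
        else recordFactor c A B o k := by
  classical
  -- Joint probability of the record `o` and the hypothetical fail bits `y`. Its total mass and its
  -- one-register marginals come from `hsum` with `S` empty or a singleton.
  let J : ({k // k ∉ A ∪ B} → Bool) → ℝ := fun y => localExpect σ fun k =>
    if h : k ∉ A ∪ B then bitOp c j (y ⟨k, h⟩) else recordFactor c A B o k
  let ext : ({k // k ∉ A ∪ B} → Bool) → Fin N → Bool := fun y k =>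
    if h : k ∉ A ∪ B then y ⟨k, h⟩ else false
  have hext : ∀ y (k : {k // k ∉ A ∪ B}), ext y k = y k := fun y k => dif_pos k.2
  have hJ : ∀ y, 0 ≤ J y := by
    intro y
    refine localExpect_nonneg hσ _ fun k => ?_
    split_ifs
    · exact posSemidef_recordFactor c A B o k
    · exact posSemidef_bitOp _ _ _
  have hprod : ∀ (S : Finset (Fin N)), (∀ r ∈ S, r ∉ A ∪ B) → ∀ (f : Bool → ℝ) y,
      ∏ k : {k // k ∉ A ∪ B}, (if (k : Fin N) ∈ S then f (y k) else 1)
        = ∏ r ∈ S, f (ext y r) := by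
    intro S hS f y
    rw [← prod_subtype_ite_mem (fun k => k ∉ A ∪ B) S hS fun r => f (ext y r)]
    simp only [hext]
  have hsum : ∀ (S : Finset (Fin N)), (∀ r ∈ S, r ∉ A ∪ B) → ∀ (f : Bool → ℝ),
      ∑ y, J y * ∏ r ∈ S, f (ext y r) = localExpect σ fun k => if k ∉ A ∪ B then
        ∑ b, ((if k ∈ S then f b else 1 : ℝ) : ℂ) • bitOp c j b
        else recordFactor c A B o k := by
    intro S hS f
    rw [← sum_localExpect σ (fun k => k ∉ A ∪ B) (fun k b => if k ∈ S then f b else 1)]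
    refine Finset.sum_congr rfl fun y _ => ?_
    rw [mul_comm, ← hprod S hS]
  have hborn0 : 0 ≤ bornProb c σ A B o := by
    rw [bornProb_eq]
    exact localExpect_nonneg hσ _ (posSemidef_recordFactor c A B o)
  have hexp : ∀ y, Real.exp (t * ((∑ r ∈ R, bitVal (ext y r)) / R.card))
      = ∏ r ∈ R, Real.exp (t / R.card * bitVal (ext y r)) := by
    intro y
    rw [← Real.exp_sum, ← Finset.mul_sum]
    congr 1
    ring
  rw [← hsum R hR]
  rcases hborn0.eq_or_lt with h0 | hpos
  · rw [← h0, zero_mul]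
    exact Finset.sum_nonneg fun y _ => mul_nonneg (hJ y)
      (Finset.prod_nonneg fun r _ => (Real.exp_pos _).le)
  have hJw : ∑ y, J y = bornProb c σ A B o := by
    have h := hsum ∅ (by simp) fun _ => 1
    simp only [Finset.prod_empty, mul_one, Finset.notMem_empty, if_false, Complex.ofReal_one,
      one_smul, sum_bitOp] at h
    rw [h, bornProb_eq]
    congr 1
    funext k
    split_ifs with hk
    · rfl
    · exact (recordFactor_of_notMem c o hk).symm
  have hJr : ∀ r ∈ R, ∑ y, J y * bitVal (ext y r)
      = localExpect σ (Function.update (recordFactor c A B o) r (bitOp c j true)) := by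
    intro r hr
    have h := hsum {r} (by simpa using hR r hr) bitVal
    simp only [Finset.prod_singleton, Finset.mem_singleton] at h
    rw [h]
    congr 1
    funext k
    by_cases hk : k = r
    · subst hk
      rw [if_pos (hR k hr), Function.update_self]
      simp [bitVal]
    · rw [Function.update_of_ne hk]
      simp only [hk, if_false, Complex.ofReal_one, one_smul, sum_bitOp]
      split_ifs with hk'
      · rfl
      · exact (recordFactor_of_notMem c o hk').symm
  have hX : t * restFail c σ A B R o j
      = (∑ y, J y * (t * ((∑ r ∈ R, bitVal (ext y r)) / R.card))) / bornProb c σ A B o := by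
    have : ∑ y, J y * (t * ((∑ r ∈ R, bitVal (ext y r)) / R.card))
        = t * ((∑ r ∈ R, ∑ y, J y * bitVal (ext y r)) / R.card) := by
      rw [Finset.sum_comm, Finset.sum_div, Finset.mul_sum]
      refine Finset.sum_congr rfl fun y _ => ?_
      rw [← Finset.mul_sum]
      ring
    rw [this, Finset.sum_congr rfl hJr, restFail]
    ring
  rw [hX]
  refine (mul_exp_div_le_sum Finset.univ J _ (fun y _ => hJ y) hpos hJw).trans_eq ?_
  simp only [hexp]

open scoped ComplexOrder in
theorem sum_bornProb_mul_exp_le (c : G.Coloring (Fin 2))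
    {σ : Matrix (Registers N n) (Registers N n) ℂ} (hσ : σ.PosSemidef)
    (A B R T : Finset (Fin N)) (hR : ∀ r ∈ R, r ∉ A ∪ B) (j : Fin 2) (t : ℝ)
    (hT : T ⊆ A ∪ B) (hTj : ∀ k ∈ T, (if k ∈ A then (0 : Fin 2) else 1) = j) :
    ∑ o : MeasRecord n A B, bornProb c σ A B o *
        Real.exp (t * (restFail c σ A B R o j - failCount c A B o j T / T.card))
      ≤ failMoment c σ j t R T := by
  classical
  have hfc : ∀ o : MeasRecord n A B, Real.exp (-(t * (failCount c A B o j T / T.card)))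
      = ∏ k : {k // k ∈ A ∪ B}, (if (k : Fin N) ∈ T then
          Real.exp (-(t / T.card) * bitVal (failBit c j (o k))) else 1) := by
    intro o
    have h1 : (failCount c A B o j T : ℝ) = ∑ k : {k // k ∈ A ∪ B},
        if (k : Fin N) ∈ T then bitVal (failBit c j (o k)) else 0 := by
      rw [failCount, Finset.card_filter]
      push_cast
      refine Finset.sum_congr rfl fun k _ => ?_
      by_cases hk : (k : Fin N) ∈ T <;> simp [hk, bitVal, failBit]
    have h2 : -(t * (failCount c A B o j T / T.card)) = ∑ k : {k // k ∈ A ∪ B},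
        if (k : Fin N) ∈ T then -(t / T.card) * bitVal (failBit c j (o k)) else 0 := by
      rw [h1]
      have : ∀ k : {k // k ∈ A ∪ B},
          (if (k : Fin N) ∈ T then -(t / T.card) * bitVal (failBit c j (o k)) else 0)
          = -(t / T.card) * if (k : Fin N) ∈ T then bitVal (failBit c j (o k)) else 0 := by
        intro k; split_ifs <;> simp
      simp only [this, ← Finset.mul_sum]
      ring
    rw [h2, Real.exp_sum]
    refine Finset.prod_congr rfl fun k _ => ?_
    split_ifs <;> simp
  let Q : Fin N → Matrix (Qubits n) (Qubits n) ℂ := fun k =>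
    ∑ b, ((if k ∈ R then Real.exp (t / R.card * bitVal b) else 1 : ℝ) : ℂ) • bitOp c j b
  have hstep : ∀ o : MeasRecord n A B, bornProb c σ A B o *
        Real.exp (t * (restFail c σ A B R o j - failCount c A B o j T / T.card))
      ≤ (∏ k : {k // k ∈ A ∪ B}, (if (k : Fin N) ∈ T then
          Real.exp (-(t / T.card) * bitVal (failBit c j (o k))) else 1)) *
        localExpect σ fun k => if h : k ∈ A ∪ B then
          outcomeProj (colorSet c (if k ∈ A then 0 else 1)) (o ⟨k, h⟩) else Q k := by
    intro o
    rw [← hfc, mul_sub, sub_eq_add_neg, Real.exp_add, ← mul_assoc, mul_comm]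
    refine mul_le_mul_of_nonneg_left ?_ (Real.exp_pos _).le
    refine (bornProb_mul_exp_restFail_le c hσ A B R hR o j t).trans_eq ?_
    congr 1
    funext k
    by_cases hk : k ∈ A ∪ B
    · simp only [hk, not_true, if_false, dite_true, recordFactor]
    · simp only [hk, not_false_eq_true, if_true, dite_false, Q]
  refine (Finset.sum_le_sum fun o _ => hstep o).trans_eq ?_
  rw [sum_localExpect_mem σ (A ∪ B)
    (fun k o => if k ∈ T then Real.exp (-(t / T.card) * bitVal (failBit c j o)) else 1)
    (fun k o => outcomeProj (colorSet c (if k ∈ A then 0 else 1)) o) Q]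
  let U : Fin N → Bool → ℝ := fun k b => (if k ∈ R then Real.exp (t / R.card * bitVal b) else 1) *
    (if k ∈ T then Real.exp (-(t / T.card) * bitVal b) else 1)
  have hU : (fun k => if k ∈ A ∪ B then ∑ o : Qubits n,
      (((if k ∈ T then Real.exp (-(t / T.card) * bitVal (failBit c j o)) else 1 : ℝ)) : ℂ) •
        outcomeProj (colorSet c (if k ∈ A then 0 else 1)) o else Q k)
      = fun k => ∑ b, ((U k b : ℝ) : ℂ) • bitOp c j b := by
    funext k
    by_cases hk : k ∈ A ∪ B
    · have hkR : k ∉ R := fun h => hR k h hk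
      rw [if_pos hk]
      by_cases hkT : k ∈ T
      · simp only [hkT, if_true, U, hkR, if_false, one_mul, hTj k hkT]
        exact sum_smul_outcomeProj c j fun b => ((Real.exp (-(t / T.card) * bitVal b) : ℝ) : ℂ)
      -- A measured register outside `T` carries weight 1. Complete measurements of either setting
      -- sum to the identity, so its actual setting may be replaced by test `j`.
      · simp only [hkT, if_false, U, hkR, one_mul, Complex.ofReal_one, one_smul, sum_bitOp,
          sum_outcomeProj]
    · have hkT : k ∉ T := fun h => hk (hT h)
      rw [if_neg hk]
      simp only [Q, U, hkT, if_false, mul_one]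
  rw [hU, ← sum_localExpect_univ σ U fun _ b => bitOp c j b, failMoment]
  refine Finset.sum_congr rfl fun z _ => ?_
  rw [mul_comm]
  congr 1
  simp only [U, Finset.prod_mul_distrib, Finset.prod_ite_mem, Finset.univ_inter]
  rw [← Real.exp_sum, ← Real.exp_sum, ← Real.exp_add, ← Finset.mul_sum, ← Finset.mul_sum, avgDiff]
  congr 1
  ring

theorem sum_bornProb (c : G.Coloring (Fin 2)) {σ : Matrix (Registers N n) (Registers N n) ℂ}
    (hσ : σ.trace = 1) (A B : Finset (Fin N)) :
    ∑ o : MeasRecord n A B, bornProb c σ A B o = 1 := by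
  have h := sum_localExpect_mem σ (A ∪ B) (fun _ _ => 1)
    (fun k o => outcomeProj (colorSet c (if k ∈ A then 0 else 1)) o) fun _ => 1
  simp only [Finset.prod_const_one, one_mul, Complex.ofReal_one, one_smul, sum_outcomeProj,
    ite_self, localExpect_one hσ] at h
  rw [← h]
  exact Finset.sum_congr rfl fun o _ => bornProb_eq c σ A B o

end

end PVBQC
namespace PVBQC

/-! ### Tail bounds -/

noncomputable section

variable {N n : ℕ} {G : SimpleGraph (Fin n)}

theorem sum_perm_exp_avgDiff_le {α : Type*} [Fintype α] [DecidableEq α] (x : α → ℝ)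
    (hx : ∀ i j, |x i - x j| ≤ 1) (t : ℝ) {K m : ℕ} (T R : Finset α) (hTR : Disjoint T R)
    (hm : 0 < m) (hK : 0 < K) (hT : T.card = K) (hR : R.card = m * K) :
    ∑ π : Equiv.Perm α,
        Real.exp (t * avgDiff x (R.map π.toEmbedding) (T.map π.toEmbedding))
      ≤ Real.exp (t ^ 2 / (2 * K)) * Fintype.card (Equiv.Perm α) := by
  subst hT
  have h := sum_perm_exp_sub_avg_le x hx t T R hTR hm hK hR
  simpa only [avgDiff, Finset.sum_map, Finset.card_map, Equiv.coe_toEmbedding] using h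

theorem compl_map_perm {α : Type*} [Fintype α] [DecidableEq α] (π : Equiv.Perm α)
    (C : Finset α) : (C.map π.toEmbedding)ᶜ = Cᶜ.map π.toEmbedding := by
  rw [Finset.compl_eq_univ_sdiff, Finset.compl_eq_univ_sdiff, Finset.map_sdiff,
    Finset.map_univ_equiv]

/-- Equivariance of `T` and `R` turns relabelled selections into relabelled groups. What remains is
the permutation bound for fixed disjoint sets of sizes `K` and `m * K`. -/
theorem expect_exp_avgDiff_le {α : Type*} [Fintype α] [DecidableEq α] (x : α → ℝ)
    (hx : ∀ i j, |x i - x j| ≤ 1) (t : ℝ) {K m h d : ℕ} (hm : 0 < m) (hK : 0 < K)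
    (hh : h ≤ Fintype.card α) (hd : d ≤ h) (T R : Finset α → Finset α → Finset α)
    (hTmap : ∀ (π : Equiv.Perm α) C A, T (C.map π.toEmbedding) (A.map π.toEmbedding)
      = (T C A).map π.toEmbedding)
    (hRmap : ∀ (π : Equiv.Perm α) C A, R (C.map π.toEmbedding) (A.map π.toEmbedding)
      = (R C A).map π.toEmbedding)
    (hTR : ∀ C A, C.card = h → A ⊆ C → A.card = d →
      Disjoint (T C A) (R C A) ∧ (T C A).card = K ∧ (R C A).card = m * K) :
    (Finset.expect (Finset.powersetCard h Finset.univ) fun C =>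
      Finset.expect (Finset.powersetCard d C) fun A =>
        Real.exp (t * avgDiff x (R C A) (T C A))) ≤ Real.exp (t ^ 2 / (2 * K)) := by
  refine expect_le_of_perm (Finset.powersetCard h (Finset.univ : Finset α))
    (Finset.powersetCard_nonempty.2 (by simpa using hh))
    (fun π C => Finset.expect (Finset.powersetCard d C) fun A =>
      Real.exp (t * avgDiff x ((R C A).map π.toEmbedding) ((T C A).map π.toEmbedding))) _ _ ?_ ?_
  · intro π
    nth_rewrite 1 [← Finset.map_univ_equiv π]
    rw [expect_powersetCard_map]
    refine Finset.expect_congr rfl fun C _ => ?_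
    rw [expect_powersetCard_map]
    simp only [hTmap, hRmap]
  · intro C hC
    have hC' := (Finset.mem_powersetCard.1 hC).2
    rw [← Finset.expect_sum_comm]
    refine Finset.expect_le (Finset.powersetCard_nonempty.2 (hd.trans hC'.ge)) fun A hA => ?_
    obtain ⟨hA1, hA2⟩ := Finset.mem_powersetCard.1 hA
    obtain ⟨h1, h2, h3⟩ := hTR C A hC' hA1 hA2
    exact sum_perm_exp_avgDiff_le x hx t _ _ h1 hm hK h2 h3

theorem expect_expect_exp_avgDiff_le {α : Type*} [Fintype α] [DecidableEq α] (x : α → ℝ)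
    (hx : ∀ i j, |x i - x j| ≤ 1) (t : ℝ) {K m g h d : ℕ} (hm : 0 < m) (hK : 0 < K)
    (hg : g + h ≤ Fintype.card α) (hd : d ≤ h) (T R : Finset α → Finset α → Finset α → Finset α)
    (hTmap : ∀ (π : Equiv.Perm α) C D A,
      T (C.map π.toEmbedding) (D.map π.toEmbedding) (A.map π.toEmbedding)
      = (T C D A).map π.toEmbedding)
    (hRmap : ∀ (π : Equiv.Perm α) C D A,
      R (C.map π.toEmbedding) (D.map π.toEmbedding) (A.map π.toEmbedding)
      = (R C D A).map π.toEmbedding)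
    (hTR : ∀ C D A, C.card = g → D ⊆ Cᶜ → D.card = h → A ⊆ D → A.card = d →
      Disjoint (T C D A) (R C D A) ∧ (T C D A).card = K ∧ (R C D A).card = m * K) :
    (Finset.expect (Finset.powersetCard g Finset.univ) fun C =>
      Finset.expect (Finset.powersetCard h Cᶜ) fun D =>
        Finset.expect (Finset.powersetCard d D) fun A =>
        Real.exp (t * avgDiff x (R C D A) (T C D A))) ≤ Real.exp (t ^ 2 / (2 * K)) := by
  refine expect_le_of_perm (Finset.powersetCard g (Finset.univ : Finset α))
    (Finset.powersetCard_nonempty.2 (by rw [Finset.card_univ]; omega))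
    (fun π C => Finset.expect (Finset.powersetCard h Cᶜ) fun D =>
      Finset.expect (Finset.powersetCard d D) fun A =>
      Real.exp (t * avgDiff x ((R C D A).map π.toEmbedding) ((T C D A).map π.toEmbedding)))
      _ _ ?_ ?_
  · intro π
    nth_rewrite 1 [← Finset.map_univ_equiv π]
    rw [expect_powersetCard_map]
    refine Finset.expect_congr rfl fun C _ => ?_
    rw [compl_map_perm, expect_powersetCard_map]
    refine Finset.expect_congr rfl fun D _ => ?_
    rw [expect_powersetCard_map]
    simp only [hTmap, hRmap]
  · intro C hC
    have hC' := (Finset.mem_powersetCard.1 hC).2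
    rw [← Finset.expect_sum_comm]
    refine Finset.expect_le (Finset.powersetCard_nonempty.2
      (by rw [Finset.card_compl]; omega)) fun D hD => ?_
    obtain ⟨hD1, hD2⟩ := Finset.mem_powersetCard.1 hD
    rw [← Finset.expect_sum_comm]
    refine Finset.expect_le (Finset.powersetCard_nonempty.2 (hd.trans hD2.ge)) fun A hA => ?_
    obtain ⟨hA1, hA2⟩ := Finset.mem_powersetCard.1 hA
    obtain ⟨h1, h2, h3⟩ := hTR C D A hC' hD1 hD2 hA1 hA2
    exact sum_perm_exp_avgDiff_le x hx t _ _ h1 hm hK h2 h3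

/-- Separates the two tests without any independence between them, at the price of doubling the
exponent. -/
theorem exp_mul_add_le (s a b : ℝ) :
    Real.exp (s * (a + b)) ≤ (Real.exp (2 * s * a) + Real.exp (2 * s * b)) / 2 := by
  have h1 : Real.exp (2 * s * a) = Real.exp (s * a) ^ 2 := by
    rw [← Real.exp_nat_mul]; congr 1; push_cast; ring
  have h2 : Real.exp (2 * s * b) = Real.exp (s * b) ^ 2 := by
    rw [← Real.exp_nat_mul]; congr 1; push_cast; ring
  rw [h1, h2, mul_add, Real.exp_add]
  nlinarith [sq_nonneg (Real.exp (s * a) - Real.exp (s * b))]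

-- Markov's inequality: when the implication fails on a record of positive probability, the two
-- deviations add up to at least `x`, so exp(-s x) times the exponential of `s` times their sum is
-- at least 1.
open scoped Classical ComplexOrder in
theorem one_sub_le_sum_bornProb (c : G.Coloring (Fin 2))
    {σ : Matrix (Registers N n) (Registers N n) ℂ} (hσ : IsDensity σ)
    {A B R : Finset (Fin N)} {K : ℕ} (hK : 0 < K) (hA : A.card = K) (hB : B.card = K)
    (hAB : Disjoint A B) (hR : ∀ r ∈ R, r ∉ A ∪ B) (hR0 : 0 < R.card) {s x κ δ : ℝ} (hs : 0 ≤ s)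
    (hx : x + κ / K ≤ δ) :
    1 - Real.exp (-(s * x)) * ((failMoment c σ 0 (2 * s) R A + failMoment c σ 1 (2 * s) R B) / 2) ≤
      ∑ o : MeasRecord n A B, if ((failCount c A B o 0 A : ℝ) + (failCount c A B o 1 B : ℝ) ≤ κ →
        1 - δ ≤ restFidelity c σ A B R o) then bornProb c σ A B o else 0 := by
  have hK' : (0 : ℝ) < K := by exact_mod_cast hK
  set e : Fin 2 → Finset (Fin N) → MeasRecord n A B → ℝ := fun j T o =>
    Real.exp (2 * s * (restFail c σ A B R o j - failCount c A B o j T / T.card)) with he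
  have h0 := sum_bornProb_mul_exp_le c hσ.1 A B R A hR 0 (2 * s) Finset.subset_union_left
    fun k hk => by simp [hk]
  have h1 := sum_bornProb_mul_exp_le c hσ.1 A B R B hR 1 (2 * s) Finset.subset_union_right
    fun k hk => by simp [Finset.disjoint_right.1 hAB hk]
  have hb : ∀ o : MeasRecord n A B, 0 ≤ bornProb c σ A B o := fun o => by
    rw [bornProb_eq]
    exact localExpect_nonneg hσ.1 _ (posSemidef_recordFactor c A B o)
  have hstep : ∀ o : MeasRecord n A B, bornProb c σ A B o ≤
      (if ((failCount c A B o 0 A : ℝ) + (failCount c A B o 1 B : ℝ) ≤ κ →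
        1 - δ ≤ restFidelity c σ A B R o) then bornProb c σ A B o else 0)
      + Real.exp (-(s * x)) * ((bornProb c σ A B o * e 0 A o + bornProb c σ A B o * e 1 B o) / 2) := by
    intro o
    have hpos : 0 ≤ Real.exp (-(s * x)) *
        ((bornProb c σ A B o * e 0 A o + bornProb c σ A B o * e 1 B o) / 2) := by
      have := hb o
      positivity
    split_ifs with hE
    · linarith
    -- Records of probability zero have no meaningful post-measurement state, but they carry no
    -- weight.
    · rcases (hb o).eq_or_lt with hz | hp
      · rw [← hz] at hpos ⊢
        linarith
      push Not at hE
      obtain ⟨hκ, hF⟩ := hE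
      have hinf := one_sub_restFidelity_le c hσ.1 A B R hR hR0 o hp
      have hdiv : ((failCount c A B o 0 A : ℝ) + failCount c A B o 1 B) / K ≤ κ / K := by gcongr
      have hx' : x ≤ (restFail c σ A B R o 0 - failCount c A B o 0 A / A.card)
          + (restFail c σ A B R o 1 - failCount c A B o 1 B / B.card) := by
        rw [hA, hB]
        rw [add_div] at hdiv
        linarith
      have hone : 1 ≤ Real.exp (-(s * x)) * ((e 0 A o + e 1 B o) / 2) := by
        calc 1 = Real.exp (-(s * x)) * Real.exp (s * x) := by rw [← Real.exp_add]; simp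
          _ ≤ Real.exp (-(s * x)) * Real.exp (s * ((restFail c σ A B R o 0
                - failCount c A B o 0 A / A.card)
              + (restFail c σ A B R o 1 - failCount c A B o 1 B / B.card))) := by gcongr
          _ ≤ _ := by
              gcongr
              exact exp_mul_add_le _ _ _
      calc bornProb c σ A B o = bornProb c σ A B o * 1 := (mul_one _).symm
        _ ≤ bornProb c σ A B o * (Real.exp (-(s * x)) * ((e 0 A o + e 1 B o) / 2)) := by gcongr
        _ = _ := by ring
  have hsum := Finset.sum_le_sum fun o (_ : o ∈ Finset.univ) => hstep o
  rw [sum_bornProb c hσ.2, Finset.sum_add_distrib, ← Finset.mul_sum, ← Finset.sum_div,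
    Finset.sum_add_distrib] at hsum
  have : Real.exp (-(s * x)) * ((∑ o, bornProb c σ A B o * e 0 A o
      + ∑ o, bornProb c σ A B o * e 1 B o) / 2)
      ≤ Real.exp (-(s * x)) * ((failMoment c σ 0 (2 * s) R A + failMoment c σ 1 (2 * s) R B) / 2) := by
    gcongr
  linarith

theorem expect_sub_const_mul {ι : Type*} {S : Finset ι} (hS : S.Nonempty) (f : ι → ℝ) (a b : ℝ) :
    (Finset.expect S fun i => a - b * f i) = a - b * Finset.expect S f := by
  rw [Finset.expect_sub_distrib, Finset.expect_const hS, Finset.mul_expect]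

open scoped ComplexOrder in
/-- Averages of `failMoment` are bounded by bounding them for each classical outcome. -/
theorem sum_localExpect_bitOp_mul_le (c : G.Coloring (Fin 2))
    {σ : Matrix (Registers N n) (Registers N n) ℂ} (hσ : IsDensity σ) (j : Fin 2)
    (f : (Fin N → Bool) → ℝ) {b : ℝ} (hf : ∀ z, f z ≤ b) :
    ∑ z : Fin N → Bool, localExpect σ (fun k => bitOp c j (z k)) * f z ≤ b := by
  calc _ ≤ ∑ z : Fin N → Bool, localExpect σ (fun k => bitOp c j (z k)) * b :=
        Finset.sum_le_sum fun z _ => mul_le_mul_of_nonneg_left (hf z)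
          (localExpect_nonneg hσ.1 _ fun k => posSemidef_bitOp c j _)
    _ = b := by rw [← Finset.sum_mul, sum_localExpect_bitOp hσ.2, one_mul]

/-- With x = β√l/n, the value s = Kx/4 minimises -s x + (2s)²/(2K), giving -Kx²/8. Then K ≥ n² log n
yields n^(-β² l/8), and the factor 4 is slack. -/
theorem chernoff_exponent_le {n K : ℕ} (hn : 2 ≤ n) (hK : (n : ℝ) ^ 2 * Real.log n ≤ K)
    {l β γ : ℝ} (hl : 0 ≤ l) (hγ : 8 * γ ≤ β ^ 2) :
    Real.exp (-((K * (β * Real.sqrt l / n) / 4) * (β * Real.sqrt l / n))) *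
        Real.exp ((2 * (K * (β * Real.sqrt l / n) / 4)) ^ 2 / (2 * K))
      ≤ 4 * (n : ℝ) ^ (-(γ * l)) := by
  have hn' : (1 : ℝ) < n := by exact_mod_cast hn
  have hlog : 0 < Real.log n := Real.log_pos hn'
  have hKpos : (0 : ℝ) < K := lt_of_lt_of_le (by positivity) hK
  have hsq : Real.sqrt l ^ 2 = l := Real.sq_sqrt hl
  have hK' : Real.log n ≤ K / n ^ 2 := by
    rw [le_div_iff₀ (by positivity)]; linarith
  rw [← Real.exp_add, Real.rpow_def_of_pos (by linarith)]
  have hexp : -((K * (β * Real.sqrt l / n) / 4) * (β * Real.sqrt l / n))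
      + (2 * (K * (β * Real.sqrt l / n) / 4)) ^ 2 / (2 * K) = -(β ^ 2 * l / 8 * (K / n ^ 2)) := by
    have : -((K * (β * Real.sqrt l / n) / 4) * (β * Real.sqrt l / n))
      + (2 * (K * (β * Real.sqrt l / n) / 4)) ^ 2 / (2 * K)
        = -(β ^ 2 * Real.sqrt l ^ 2 / 8 * (K / n ^ 2)) := by
      field_simp; ring
    rw [this, hsq]
  rw [hexp]
  have h1 : Real.exp (-(β ^ 2 * l / 8 * (K / n ^ 2))) ≤ Real.exp (Real.log n * -(γ * l)) := by
    apply Real.exp_le_exp.2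
    have h2 : γ * l * Real.log n ≤ β ^ 2 * l / 8 * Real.log n := by
      gcongr
      nlinarith
    have h3 : β ^ 2 * l / 8 * Real.log n ≤ β ^ 2 * l / 8 * (K / n ^ 2) := by gcongr
    linarith
  have := Real.exp_pos (Real.log n * -(γ * l))
  linarith

theorem copies_pos {n : ℕ} (hn : 2 ≤ n) : 0 < copies n := by
  have hn' : (1 : ℝ) < n := by exact_mod_cast hn
  have := Real.log_pos hn'
  exact Nat.ceil_pos.2 (by positivity)

theorem thirdParty_tail_bound {K : ℕ} (hK : 0 < K) (c : G.Coloring (Fin 2))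
    {σ : Matrix (Registers (5 * K) n) (Registers (5 * K) n) ℂ} (hσ : IsDensity σ)
    {s x κ δ : ℝ} (hs : 0 ≤ s) (hx : x + κ / K ≤ δ) :
    1 - Real.exp (-(s * x)) * Real.exp ((2 * s) ^ 2 / (2 * K)) ≤
      Finset.expect (Finset.powersetCard (2 * K) Finset.univ) fun C =>
        verificationProb c σ K C Cᶜ fun K₁ K₂ F =>
          (K₁ : ℝ) + (K₂ : ℝ) ≤ κ → 1 - δ ≤ F := by
  classical
  have hne1 : (Finset.powersetCard (2 * K) (Finset.univ : Finset (Fin (5 * K)))).Nonempty :=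
    Finset.powersetCard_nonempty.2 (by simp; omega)
  have hne2 : ∀ C ∈ Finset.powersetCard (2 * K) (Finset.univ : Finset (Fin (5 * K))),
      (Finset.powersetCard K C).Nonempty := fun C hC =>
    Finset.powersetCard_nonempty.2 (by rw [(Finset.mem_powersetCard.1 hC).2]; omega)
  have hmoment : ∀ (j : Fin 2) (T : Finset (Fin (5 * K)) → Finset (Fin (5 * K)) → Finset (Fin (5 * K))),
      (∀ (π : Equiv.Perm (Fin (5 * K))) C A, T (C.map π.toEmbedding) (A.map π.toEmbedding)
        = (T C A).map π.toEmbedding) →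
      (∀ C A, C.card = 2 * K → A ⊆ C → A.card = K → T C A ⊆ C ∧ (T C A).card = K) →
      (Finset.expect (Finset.powersetCard (2 * K) Finset.univ) fun C =>
        Finset.expect (Finset.powersetCard K C) fun A => failMoment c σ j (2 * s) Cᶜ (T C A))
        ≤ Real.exp ((2 * s) ^ 2 / (2 * K)) := by
    intro j T hTmap hT
    refine Eq.trans_le ?_ (sum_localExpect_bitOp_mul_le c hσ j (fun z =>
      Finset.expect (Finset.powersetCard (2 * K) Finset.univ) fun C =>
      Finset.expect (Finset.powersetCard K C) fun A =>
        Real.exp (2 * s * avgDiff (fun k => bitVal (z k)) Cᶜ (T C A))) fun z => ?_)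
    -- The law of the fail bits does not involve the selections, so the average over selections can
    -- be taken first, for each fixed bit string.
    · simp only [failMoment, Finset.expect_sum_comm, ← Finset.mul_expect]
    -- The complement of `C` has `3 * K` registers against `K` in each tested group, hence `m := 3`.
    refine expect_exp_avgDiff_le (fun k => bitVal (z k)) (fun _ _ => abs_bitVal_sub_le _ _) (2 * s)
      (m := 3) (by norm_num) hK (by simp; omega) (by omega) T (fun C _ => Cᶜ) hTmap
      (fun π C _ => compl_map_perm π C) fun C A hC hAC hA => ?_
    obtain ⟨h1, h2⟩ := hT C A hC hAC hA
    refine ⟨Finset.disjoint_left.2 fun k hk hk' => Finset.mem_compl.1 hk' (h1 hk), h2, ?_⟩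
    rw [Finset.card_compl, Fintype.card_fin]
    omega
  have hm0 := hmoment 0 (fun _ A => A) (fun _ _ _ => rfl) fun C A _ hAC hA => ⟨hAC, hA⟩
  have hm1 := hmoment 1 (fun C A => C \ A) (fun π C A => (Finset.map_sdiff ..).symm)
    fun C A hC hAC hA => ⟨Finset.sdiff_subset, by rw [Finset.card_sdiff_of_subset hAC]; omega⟩
  have hmain : (Finset.expect (Finset.powersetCard (2 * K) Finset.univ) fun C =>
        Finset.expect (Finset.powersetCard K C) fun A =>
        (1 - Real.exp (-(s * x)) * ((failMoment c σ 0 (2 * s) Cᶜ A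
          + failMoment c σ 1 (2 * s) Cᶜ (C \ A)) / 2))) ≤
      Finset.expect (Finset.powersetCard (2 * K) Finset.univ) fun C =>
        verificationProb c σ K C Cᶜ fun K₁ K₂ F =>
          (K₁ : ℝ) + (K₂ : ℝ) ≤ κ → 1 - δ ≤ F := by
    refine Finset.expect_le_expect fun C hC => Finset.expect_le_expect fun A hA => ?_
    obtain ⟨hAC, hA⟩ := Finset.mem_powersetCard.1 hA
    have hC := (Finset.mem_powersetCard.1 hC).2
    refine (one_sub_le_sum_bornProb c hσ hK hA (by rw [Finset.card_sdiff_of_subset hAC]; omega)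
      Finset.disjoint_sdiff (fun r hr => ?_) ?_ hs hx).trans_eq ?_
    · rw [Finset.union_sdiff_of_subset hAC]
      exact Finset.mem_compl.1 hr
    · rw [Finset.card_compl, Fintype.card_fin]
      omega
    · exact Finset.sum_congr rfl fun o _ => by congr
  refine le_trans ?_ hmain
  rw [Finset.expect_congr rfl fun C hC => expect_sub_const_mul (hne2 C hC) _ _ _,
    expect_sub_const_mul hne1]
  simp only [← Finset.expect_div, Finset.expect_add_distrib]
  gcongr
  linarith

theorem firstClient_tail_bound {K : ℕ} (hK : 0 < K) (c : G.Coloring (Fin 2))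
    {σ : Matrix (Registers (5 * K) n) (Registers (5 * K) n) ℂ} (hσ : IsDensity σ)
    {s x κ δ : ℝ} (hs : 0 ≤ s) (hx : x + κ / K ≤ δ) :
    1 - Real.exp (-(s * x)) * Real.exp ((2 * s) ^ 2 / (2 * K)) ≤
      Finset.expect (Finset.powersetCard (2 * K) Finset.univ) fun C =>
        Finset.expect (Finset.powersetCard (2 * K) Cᶜ) fun D =>
          verificationProb c σ K D (Cᶜ \ D) fun K₁ K₂ F =>
            (K₁ : ℝ) + (K₂ : ℝ) ≤ κ → 1 - δ ≤ F := by
  classical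
  have hne1 : (Finset.powersetCard (2 * K) (Finset.univ : Finset (Fin (5 * K)))).Nonempty :=
    Finset.powersetCard_nonempty.2 (by simp; omega)
  have hne2 : ∀ C ∈ Finset.powersetCard (2 * K) (Finset.univ : Finset (Fin (5 * K))),
      (Finset.powersetCard (2 * K) Cᶜ).Nonempty := fun C hC =>
    Finset.powersetCard_nonempty.2 (by
      rw [Finset.card_compl, Fintype.card_fin, (Finset.mem_powersetCard.1 hC).2]; omega)
  have hne3 : ∀ C : Finset (Fin (5 * K)), ∀ D ∈ Finset.powersetCard (2 * K) Cᶜ,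
      (Finset.powersetCard K D).Nonempty := fun C D hD =>
    Finset.powersetCard_nonempty.2 (by rw [(Finset.mem_powersetCard.1 hD).2]; omega)
  have hcard : ∀ C D : Finset (Fin (5 * K)), C.card = 2 * K → D ⊆ Cᶜ → D.card = 2 * K →
      (Cᶜ \ D).card = 1 * K := by
    intro C D hC hDC hD
    rw [Finset.card_sdiff_of_subset hDC, Finset.card_compl, Fintype.card_fin]
    omega
  have hmoment : ∀ (j : Fin 2) (T : Finset (Fin (5 * K)) → Finset (Fin (5 * K)) → Finset (Fin (5 * K))),
      (∀ (π : Equiv.Perm (Fin (5 * K))) D A, T (D.map π.toEmbedding) (A.map π.toEmbedding)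
        = (T D A).map π.toEmbedding) →
      (∀ D A, D.card = 2 * K → A ⊆ D → A.card = K → T D A ⊆ D ∧ (T D A).card = K) →
      (Finset.expect (Finset.powersetCard (2 * K) Finset.univ) fun C =>
        Finset.expect (Finset.powersetCard (2 * K) Cᶜ) fun D =>
        Finset.expect (Finset.powersetCard K D) fun A =>
          failMoment c σ j (2 * s) (Cᶜ \ D) (T D A))
        ≤ Real.exp ((2 * s) ^ 2 / (2 * K)) := by
    intro j T hTmap hT
    refine Eq.trans_le ?_ (sum_localExpect_bitOp_mul_le c hσ j (fun z =>
      Finset.expect (Finset.powersetCard (2 * K) Finset.univ) fun C =>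
      Finset.expect (Finset.powersetCard (2 * K) Cᶜ) fun D =>
      Finset.expect (Finset.powersetCard K D) fun A =>
        Real.exp (2 * s * avgDiff (fun k => bitVal (z k)) (Cᶜ \ D) (T D A))) fun z => ?_)
    · simp only [failMoment, Finset.expect_sum_comm, ← Finset.mul_expect]
    -- Here `K` registers remain, as many as in each tested group, hence `m := 1`.
    refine expect_expect_exp_avgDiff_le (fun k => bitVal (z k)) (fun _ _ => abs_bitVal_sub_le _ _)
      (2 * s) (m := 1) (by norm_num) hK (by simp; omega) (by omega) (fun _ D A => T D A)
      (fun C D _ => Cᶜ \ D) (fun π _ D A => hTmap π D A)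
      (fun π C D _ => by rw [compl_map_perm, Finset.map_sdiff]) fun C D A hC hDC hD hAD hA => ?_
    obtain ⟨h1, h2⟩ := hT D A hD hAD hA
    exact ⟨Finset.disjoint_left.2 fun k hk hk' => (Finset.mem_sdiff.1 hk').2 (h1 hk), h2,
      hcard C D hC hDC hD⟩
  have hm0 := hmoment 0 (fun _ A => A) (fun _ _ _ => rfl) fun D A _ hAD hA => ⟨hAD, hA⟩
  have hm1 := hmoment 1 (fun D A => D \ A) (fun π D A => (Finset.map_sdiff ..).symm)
    fun D A hD hAD hA => ⟨Finset.sdiff_subset, by rw [Finset.card_sdiff_of_subset hAD]; omega⟩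
  have hmain : (Finset.expect (Finset.powersetCard (2 * K) Finset.univ) fun C =>
        Finset.expect (Finset.powersetCard (2 * K) Cᶜ) fun D =>
        Finset.expect (Finset.powersetCard K D) fun A =>
        (1 - Real.exp (-(s * x)) * ((failMoment c σ 0 (2 * s) (Cᶜ \ D) A
          + failMoment c σ 1 (2 * s) (Cᶜ \ D) (D \ A)) / 2))) ≤
      Finset.expect (Finset.powersetCard (2 * K) Finset.univ) fun C =>
        Finset.expect (Finset.powersetCard (2 * K) Cᶜ) fun D =>
          verificationProb c σ K D (Cᶜ \ D) fun K₁ K₂ F =>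
            (K₁ : ℝ) + (K₂ : ℝ) ≤ κ → 1 - δ ≤ F := by
    refine Finset.expect_le_expect fun C hC => Finset.expect_le_expect fun D hD =>
      Finset.expect_le_expect fun A hA => ?_
    obtain ⟨hAD, hA⟩ := Finset.mem_powersetCard.1 hA
    obtain ⟨hDC, hD⟩ := Finset.mem_powersetCard.1 hD
    have hC := (Finset.mem_powersetCard.1 hC).2
    refine (one_sub_le_sum_bornProb c hσ hK hA (by rw [Finset.card_sdiff_of_subset hAD]; omega)
      Finset.disjoint_sdiff (fun r hr => ?_) ?_ hs hx).trans_eq ?_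
    · rw [Finset.union_sdiff_of_subset hAD]
      exact (Finset.mem_sdiff.1 hr).2
    · rw [hcard C D hC hDC hD]
      omega
    · exact Finset.sum_congr rfl fun o _ => by congr
  refine le_trans ?_ hmain
  rw [Finset.expect_congr rfl fun C hC => (Finset.expect_congr rfl fun D hD =>
      expect_sub_const_mul (hne3 C D hD) _ _ _).trans (expect_sub_const_mul (hne2 C hC) _ _ _),
    expect_sub_const_mul hne1]
  simp only [← Finset.expect_div, Finset.expect_add_distrib]
  gcongr
  linarith

end

end PVBQC

/-! ### Choice of the constants -/

theorem theorem1 (n : ℕ) (hn : 6 ≤ n) (G : SimpleGraph (Fin n)) (c : G.Coloring (Fin 2))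
    (σ : Matrix (PVBQC.Registers (5 * PVBQC.copies n) n)
      (PVBQC.Registers (5 * PVBQC.copies n) n) ℂ)
    (hσ : PVBQC.IsDensity σ) :
    (∀ l₁ : ℝ, Real.logb n 16 ≤ l₁ → l₁ ≤ ((n : ℝ) - 1) ^ 2 / 16 →
      1 - 4 * (n : ℝ) ^ (-(l₁ / 2)) ≤
        PVBQC.firstClientProb c σ (fun K₁ K₂ F =>
          (K₁ : ℝ) + (K₂ : ℝ) ≤ (PVBQC.copies n : ℝ) / (2 * (n : ℝ)) →
            1 - (4 * Real.sqrt l₁ + 1) / (n : ℝ) ≤ F)) ∧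
    (∀ l₂ : ℝ, Real.logb n 4 ≤ l₂ → l₂ ≤ ((n : ℝ) - 1) ^ 2 / 9 →
      1 - 4 * (n : ℝ) ^ (-l₂) ≤
        PVBQC.thirdPartyProb c σ (fun K₁ K₂ F =>
          (K₁ : ℝ) + (K₂ : ℝ) ≤ 3 * (PVBQC.copies n : ℝ) / (4 * (n : ℝ)) →
            1 - (3 * Real.sqrt l₂ + 1) / (n : ℝ) ≤ F)) := by
  have hn2 : 2 ≤ n := by omega
  have hn' : (0 : ℝ) < n := by exact_mod_cast (by omega : 0 < n)
  have hn1 : (1 : ℝ) ≤ n := by exact_mod_cast (by omega : 1 ≤ n)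
  have hK : (n : ℝ) ^ 2 * Real.log n ≤ PVBQC.copies n := Nat.le_ceil _
  have hKpos : (0 : ℝ) < PVBQC.copies n := by exact_mod_cast PVBQC.copies_pos hn2
  refine ⟨fun l hl _ => ?_, fun l hl _ => ?_⟩
  · have hl0 : 0 ≤ l := (div_nonneg (Real.log_nonneg (by norm_num)) (Real.log_nonneg hn1)).trans hl
    refine le_trans ?_ (PVBQC.firstClient_tail_bound (PVBQC.copies_pos hn2) c hσ
      (s := PVBQC.copies n * (4 * Real.sqrt l / n) / 4) (x := 4 * Real.sqrt l / n)
      (by positivity) ?_)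
    -- The exponent β²/8 is 2 here, above the required 1/2. In the third-party case it is 9/8, above
    -- 1.
    · have := PVBQC.chernoff_exponent_le hn2 hK hl0 (β := 4) (γ := 1 / 2) (by norm_num)
      rw [show 1 / 2 * l = l / 2 by ring] at this
      linarith
    -- The tolerated failures contribute 1/(2n), within the term 1/n of the fidelity bound. In the
    -- third-party case they contribute 3/(4n).
    · have h : (PVBQC.copies n : ℝ) / (2 * n) / PVBQC.copies n = 1 / 2 / n := by field_simp
      rw [h, ← add_div]
      gcongr
      norm_num
  · have hl0 : 0 ≤ l := (div_nonneg (Real.log_nonneg (by norm_num)) (Real.log_nonneg hn1)).trans hl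
    refine le_trans ?_ (PVBQC.thirdParty_tail_bound (PVBQC.copies_pos hn2) c hσ
      (s := PVBQC.copies n * (3 * Real.sqrt l / n) / 4) (x := 3 * Real.sqrt l / n)
      (by positivity) ?_)
    · have := PVBQC.chernoff_exponent_le hn2 hK hl0 (β := 3) (γ := 1) (by norm_num)
      rw [one_mul] at this
      linarith
    · have h : 3 * (PVBQC.copies n : ℝ) / (4 * n) / PVBQC.copies n = 3 / 4 / n := by field_simp
      rw [h, ← add_div]
      gcongr
      norm_num
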